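/- **Theorem 2.** Let $I=[a,b]$ with $a<b$ and let $T:I\to I$ be a one-dimensional Iwasawa continued fraction map: $I$ is covered, up to a countable set, by countably many pairwise disjoint nonempty open intervals $I_h\subseteq I$ with $0\notin I_h$, on each of which $T(x)=\varepsilon_h/x+c_h$ for some $\varepsilon_h\in\{1,-1\}$ and $c_h\in\mathbb R$; the image $TI_h$ is the full open interval $(a,b)$, except possibly for the leftmost $I_h$ (with left endpoint $a$) and the rightmost $I_h$ (with right endpoint $b$), whose image is still an open interval sharing an endpoint with $I$. Write $h:TI_h\to I_h$ for the inverse branches. Suppose that $T$ is proper, i.e. $\max\{|a|,|b|\}<1$, and that it satisfies Condition $(*)$: for any two nondegenerate subintervals $J,K$ of $I$ there is $N\ge 0$ such that $T^N(J)\cap T^N(K)$ has positive Lebesgue measure. Let $H$ be the transfer operator on the complex space $L^1(I)$, $$Hf(x)=\sum_{h}|h'(x)|\,f(h(x))\,\chi_{TI_h}(x),$$ and let $BV(I)\subset L^1(I)$ be the space of (classes of) complex functions that agree almost everywhere with a function of bounded variation on $I$. Then $H$ maps $BV(I)$ to itself, $1$ is a simple eigenvalue of $H$ on $BV(I)$ (the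 eigenspace and the generalized eigenspace of $H|_{BV(I)}$ for $1$ are one-dimensional), and $1$ is the only eigenvalue of $H$ on $BV(I)$ of modulus $1$. -/

import Mathlib

open MeasureTheory Set
open scoped ENNReal

noncomputable section

/-- A one-dimensional Iwasawa continued fraction on the interval `I = [a, b]`: a map `T : I → I`
which on each of the countably many non-overlapping open intervals `(l i, r i)`, covering `I` up to
a countable set, is an inversion plus a constant, `x ↦ ± 1 / x + c i` (on an interval that does not
contain `0`, each of the inversions `± 1 / x`, `± |1 / x|` is of the form `± 1 / x`).
Every branch is onto the full interval, except possibly the leftmost and the rightmost ones;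
the image of these is still an interval sharing an endpoint with `I`.
The values of `T` outside `[a, b]` are irrelevant. -/
structure IwasawaCF (ι : Type*) where
  /-- left endpoint of `I` -/
  a : ℝ
  /-- right endpoint of `I` -/
  b : ℝ
  /-- the transformation -/
  T : ℝ → ℝ
  /-- left endpoints of the pieces -/
  l : ι → ℝ
  /-- right endpoints of the pieces -/
  r : ι → ℝ
  /-- signs of the inversions -/
  s : ι → ℝ
  /-- translation constants -/
  c : ι → ℝ
  a_lt_b : a < b
  mapsTo : MapsTo T (Icc a b) (Icc a b)
  l_lt_r : ∀ i, l i < r i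
  a_le_l : ∀ i, a ≤ l i
  r_le_b : ∀ i, r i ≤ b
  zero_notMem : ∀ i, (0 : ℝ) ∉ Ioo (l i) (r i)
  pairwise_disjoint : Pairwise fun i j => Disjoint (Ioo (l i) (r i)) (Ioo (l j) (r j))
  countable_compl : (Icc a b \ ⋃ i, Ioo (l i) (r i)).Countable
  sign : ∀ i, s i = 1 ∨ s i = -1
  T_eq : ∀ i, ∀ x ∈ Ioo (l i) (r i), T x = s i * (1 / x) + c i
  full : ∀ i, l i ≠ a → r i ≠ b → T '' Ioo (l i) (r i) = Ioo a b
  share : ∀ i, ∃ d e, T '' Ioo (l i) (r i) = Ioo d e ∧ (d = a ∨ e = b)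

/-- Sums of functions of bounded variation have bounded variation. -/
theorem BoundedVariationOn.add_complex {f g : ℝ → ℂ} {s : Set ℝ}
    (hf : BoundedVariationOn f s) (hg : BoundedVariationOn g s) :
    BoundedVariationOn (f + g) s := by
  have h : eVariationOn (f + g) s ≤ eVariationOn f s + eVariationOn g s := by
    apply iSup_le
    rintro ⟨n, ⟨u, hu, us⟩⟩
    calc ∑ i ∈ Finset.range n, edist ((f + g) (u (i + 1))) ((f + g) (u i))
      _ ≤ ∑ i ∈ Finset.range n,
          (edist (f (u (i + 1))) (f (u i)) + edist (g (u (i + 1))) (g (u i))) :=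
        Finset.sum_le_sum fun i _ => edist_add_add_le _ _ _ _
      _ = ∑ i ∈ Finset.range n, edist (f (u (i + 1))) (f (u i)) +
          ∑ i ∈ Finset.range n, edist (g (u (i + 1))) (g (u i)) := Finset.sum_add_distrib
      _ ≤ _ := add_le_add
        (eVariationOn.sum_le_of_monotoneOn_Iic (hu.monotoneOn _) (fun i _ => us i))
        (eVariationOn.sum_le_of_monotoneOn_Iic (hu.monotoneOn _) (fun i _ => us i))
  exact ne_top_of_le_ne_top (ENNReal.add_ne_top.2 ⟨hf, hg⟩) h

namespace IwasawaCF

variable {ι : Type*} (F : IwasawaCF ι)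

/-- The continued fraction is proper if `max |a| |b| < 1`. -/
def IsProper : Prop := max |F.a| |F.b| < 1

/-- Condition (*): any two nondegenerate subintervals of `I` have images under a common iterate of
`T` that overlap in a set of positive Lebesgue measure. -/
def ConditionStar : Prop :=
  ∀ p q p' q' : ℝ, F.a ≤ p → p < q → q ≤ F.b → F.a ≤ p' → p' < q' → q' ≤ F.b →
    ∃ N : ℕ, 0 < volume (F.T^[N] '' Icc p q ∩ F.T^[N] '' Icc p' q')

/-- Lebesgue measure on `I`. -/
abbrev m : Measure ℝ := volume.restrict (Icc F.a F.b)

/-- The complex space `L¹(I)`. -/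
abbrev L1 : Type := Lp ℂ 1 F.m

/-- The space `BV(I)` of complex functions of bounded variation, as a subspace of `L¹(I)`. -/
def BV : Submodule ℂ F.L1 where
  carrier := {f | ∃ g : ℝ → ℂ, BoundedVariationOn g (Icc F.a F.b) ∧ f =ᵐ[F.m] g}
  zero_mem' := ⟨fun _ => 0, by simp [BoundedVariationOn, eVariationOn], Lp.coeFn_zero _ _ _⟩
  add_mem' := by
    rintro f₁ f₂ ⟨g₁, h₁, e₁⟩ ⟨g₂, h₂, e₂⟩
    exact ⟨g₁ + g₂, h₁.add_complex h₂, (Lp.coeFn_add f₁ f₂).trans (e₁.add e₂)⟩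
  smul_mem' := by
    rintro k f ⟨g, h, e⟩
    refine ⟨fun x => k • g x, BoundedVariationOn.smul (f := fun _ => k)
      (by simp [BoundedVariationOn, eVariationOn]) h, (Lp.coeFn_smul k f).trans ?_⟩
    filter_upwards [e] with x hx
    simp [hx]

/-- The piece `I_h` of the partition (without its endpoints). -/
def piece (i : ι) : Set ℝ := Ioo (F.l i) (F.r i)

/-- The domain `T I_h` of the inverse branch `h`. -/
def dom (i : ι) : Set ℝ := F.T '' F.piece i

/-- The inverse branch `h : T I_h → I_h`. -/
def inv (i : ι) (y : ℝ) : ℝ := F.s i / (y - F.c i)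

theorem ne_zero_of_mem {i : ι} {x : ℝ} (hx : x ∈ F.piece i) : x ≠ 0 :=
  fun h => F.zero_notMem i (h ▸ hx)

theorem sign_ne_zero (i : ι) : F.s i ≠ 0 := by
  rcases F.sign i with h | h <;> simp [h]

theorem inv_T {i : ι} {x : ℝ} (hx : x ∈ F.piece i) : F.inv i (F.T x) = x := by
  have h0 := F.ne_zero_of_mem hx
  have hs := F.sign_ne_zero i
  rw [inv, F.T_eq i x hx]
  field_simp
  simp [hs]

theorem T_inv {i : ι} {y : ℝ} (hy : y ∈ F.dom i) : F.T (F.inv i y) = y := by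
  obtain ⟨x, hx, rfl⟩ := hy
  rw [F.inv_T hx]

theorem inv_image (i : ι) : F.inv i '' F.dom i = F.piece i := by
  rw [dom, image_image]
  exact (image_congr fun x hx => F.inv_T hx).trans (image_id' _)

theorem inv_injOn (i : ι) : InjOn (F.inv i) (F.dom i) := by
  intro x hx y hy h
  rw [← F.T_inv hx, ← F.T_inv hy, h]

theorem measurableSet_dom (i : ι) : MeasurableSet (F.dom i) := by
  obtain ⟨d, e, h, -⟩ := F.share i
  rw [dom, piece, h]
  exact measurableSet_Ioo

theorem piece_subset (i : ι) : F.piece i ⊆ Icc F.a F.b := fun _ hx =>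
  ⟨(F.a_le_l i).trans hx.1.le, hx.2.le.trans (F.r_le_b i)⟩

theorem dom_subset (i : ι) : F.dom i ⊆ Icc F.a F.b := by
  rintro _ ⟨x, hx, rfl⟩
  exact F.mapsTo (F.piece_subset i hx)

theorem differentiableAt_inv {i : ι} {y : ℝ} (hy : y ∈ F.dom i) :
    DifferentiableAt ℝ (F.inv i) y := by
  obtain ⟨x, hx, rfl⟩ := hy
  have : F.T x - F.c i ≠ 0 := by
    rw [F.T_eq i x hx]
    simpa using ⟨F.sign_ne_zero i, F.ne_zero_of_mem hx⟩
  unfold inv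
  fun_prop (disch := assumption)

theorem measurable_inv (i : ι) : Measurable (F.inv i) := by
  unfold inv
  fun_prop

/-- The contribution `|h'| · (f ∘ h) · χ_{T I_h}` of one inverse branch. -/
def term (f : ℝ → ℂ) (i : ι) : ℝ → ℂ :=
  (F.dom i).indicator fun y => ((|deriv (F.inv i) y| : ℝ) : ℂ) * f (F.inv i y)

/-- The transfer operator on functions, `H f = ∑_h |h'| · (f ∘ h) · χ_{T I_h}`. -/
def transferFun (f : ℝ → ℂ) (y : ℝ) : ℂ := ∑' i, F.term f i y

theorem term_add (f g : ℝ → ℂ) (i : ι) (y : ℝ) :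
    F.term (f + g) i y = F.term f i y + F.term g i y := by
  by_cases hy : y ∈ F.dom i <;> simp [term, hy, mul_add]

theorem term_smul (k : ℂ) (f : ℝ → ℂ) (i : ι) (y : ℝ) :
    F.term (k • f) i y = k * F.term f i y := by
  by_cases hy : y ∈ F.dom i <;> simp [term, hy, mul_left_comm]

theorem term_sub (f g : ℝ → ℂ) (i : ι) (y : ℝ) :
    F.term (f - g) i y = F.term f i y - F.term g i y := by
  by_cases hy : y ∈ F.dom i <;> simp [term, hy, mul_sub]

theorem stronglyMeasurable_term {f : ℝ → ℂ} (hf : StronglyMeasurable f) (i : ι) :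
    StronglyMeasurable (F.term f i) := by
  refine Measurable.stronglyMeasurable (Measurable.indicator ?_ (F.measurableSet_dom i))
  exact (Complex.measurable_ofReal.comp (measurable_deriv _).abs).mul
    (hf.measurable.comp (F.measurable_inv i))

/-- The change of variables formula for one branch. -/
theorem lintegral_term (f : ℝ → ℂ) (i : ι) :
    ∫⁻ y, ‖F.term f i y‖ₑ ∂F.m = ∫⁻ x in F.piece i, ‖f x‖ₑ := by
  have h1 : (fun y => ‖F.term f i y‖ₑ) = (F.dom i).indicator
      fun y => ENNReal.ofReal |deriv (F.inv i) y| * ‖f (F.inv i y)‖ₑ := by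
    funext y
    by_cases hy : y ∈ F.dom i
    · simp only [term, hy, indicator_of_mem, enorm_mul]
      rw [← ofReal_norm, Complex.norm_real, Real.norm_eq_abs, abs_abs]
    · simp [term, hy]
  rw [h1, lintegral_indicator (F.measurableSet_dom i), Measure.restrict_restrict
    (F.measurableSet_dom i), inter_eq_left.2 (F.dom_subset i), ← F.inv_image i,
    lintegral_image_eq_lintegral_abs_deriv_mul (F.measurableSet_dom i)
      (fun y hy => (F.differentiableAt_inv hy).hasDerivAt.hasDerivWithinAt) (F.inv_injOn i)]

theorem term_congr {f g : ℝ → ℂ} (hf : StronglyMeasurable f) (hg : StronglyMeasurable g)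
    (h : f =ᵐ[F.m] g) (i : ι) : F.term f i =ᵐ[F.m] F.term g i := by
  have h0 : ∫⁻ y, ‖F.term (f - g) i y‖ₑ ∂F.m = 0 := by
    rw [F.lintegral_term, lintegral_eq_zero_iff (hf.sub hg).measurable.enorm]
    filter_upwards [ae_restrict_of_ae_restrict_of_subset (F.piece_subset i) h] with x hx
    simp [hx]
  rw [lintegral_eq_zero_iff (F.stronglyMeasurable_term (hf.sub hg) i).measurable.enorm] at h0
  filter_upwards [h0] with y hy
  simpa [term_sub, sub_eq_zero] using hy

variable [Countable ι]

theorem tsum_lintegral_term_le (f : ℝ → ℂ) :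
    ∑' i, ∫⁻ y, ‖F.term f i y‖ₑ ∂F.m ≤ ∫⁻ x, ‖f x‖ₑ ∂F.m := by
  simp_rw [F.lintegral_term]
  rw [← lintegral_iUnion (s := F.piece) (fun i => measurableSet_Ioo)
    F.pairwise_disjoint]
  exact lintegral_mono_set (iUnion_subset F.piece_subset)

theorem summable_term {f : ℝ → ℂ} (hf : StronglyMeasurable f) (hi : Integrable f F.m) :
    ∀ᵐ y ∂F.m, Summable fun i => ‖F.term f i y‖ := by
  refine summable_norm_of_tsum_eLpNorm_ne_top le_rfl
    (fun i => (F.stronglyMeasurable_term hf i).aestronglyMeasurable) ?_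
  simp_rw [eLpNorm_one_eq_lintegral_enorm]
  exact ((F.tsum_lintegral_term_le f).trans_lt hi.2).ne

theorem integrable_transferFun {f : ℝ → ℂ} (hf : StronglyMeasurable f)
    (hi : Integrable f F.m) : Integrable (F.transferFun f) F.m := by
  refine ⟨?_, ?_⟩
  · refine aestronglyMeasurable_of_tendsto_ae (Filter.atTop : Filter (Finset ι))
      (f := fun t y => ∑ i ∈ t, F.term f i y) (fun t => ?_) ?_
    · exact (Finset.stronglyMeasurable_fun_sum t
        fun i _ => F.stronglyMeasurable_term hf i).aestronglyMeasurable
    · filter_upwards [F.summable_term hf hi] with y hy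
      exact hy.of_norm.hasSum
  · refine lt_of_le_of_lt ?_ ((F.tsum_lintegral_term_le f).trans_lt hi.2)
    rw [← lintegral_tsum fun i => (F.stronglyMeasurable_term hf i).enorm.aemeasurable]
    exact lintegral_mono fun y => enorm_tsum_le_tsum_enorm

/-- The transfer operator `H` on `L¹(I)`. -/
def transfer : F.L1 →ₗ[ℂ] F.L1 where
  toFun f := (F.integrable_transferFun (Lp.stronglyMeasurable f) (L1.integrable_coeFn f)).toL1 _
  map_add' f g := by
    rw [← Integrable.toL1_add, Integrable.toL1_eq_toL1_iff]
    have h := ae_all_iff.2 fun i => F.term_congr (Lp.stronglyMeasurable (f + g))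
      ((Lp.stronglyMeasurable f).add (Lp.stronglyMeasurable g)) (Lp.coeFn_add f g) i
    filter_upwards [h, F.summable_term (Lp.stronglyMeasurable f) (L1.integrable_coeFn f),
      F.summable_term (Lp.stronglyMeasurable g) (L1.integrable_coeFn g)] with y h1 h2 h3
    simp only [transferFun, Pi.add_apply]
    rw [← h2.of_norm.tsum_add h3.of_norm]
    exact tsum_congr fun i => (h1 i).trans (F.term_add _ _ i y)
  map_smul' k f := by
    rw [RingHom.id_apply, ← Integrable.toL1_smul, Integrable.toL1_eq_toL1_iff]
    have h := ae_all_iff.2 fun i => F.term_congr (Lp.stronglyMeasurable (k • f))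
      ((Lp.stronglyMeasurable f).const_smul k) (Lp.coeFn_smul k f) i
    filter_upwards [h] with y h1
    simp only [transferFun, smul_eq_mul]
    rw [← tsum_mul_left]
    exact tsum_congr fun i => (h1 i).trans (F.term_smul k _ i y)

end IwasawaCF

end

/-!
The proof is Rychlik's approach to piecewise expanding maps, with the needed compactness and
spectral theory done by hand.

*Lasota–Yorke inequality.* Let `wₙ = 1 / |(Tⁿ)'|` on the open `n`-cylinders and `wₙ = 0` elsewhere
(`IwasawaCF.weight`); then `0 ≤ wₙ ≤ σₙ` with `σₙ = max(|a|, |b|)^(2n)`, which is small for large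
`n` as `T` is proper. Each term of `H f` is a monotone reparametrization of `x² f(x)` on one piece, extended by
zero. Hence `Var (H f) ≤ Var (w₁ f)`, and as `w · H f = H ((w ∘ T) f)`, by induction
`Var (Hⁿ f) ≤ Var (wₙ f)`, without any bookkeeping of the cylinders of order `n` that have a
non-full image. The weight `wₙ` has bounded variation, because the suprema of `x²` over the pieces
are summable: on a full piece `x²` is comparable to the length of the piece, and at most two pieces
are not full. On a fine enough finite partition the variation of `wₙ` on each cell is at most
`4 σₙ` (jumps cannot be avoided), and this gives
`Var (Hⁿ f) ≤ 5 σₙ Var f + C ‖f‖₁` with `5 σₙ ≤ 1 / 2` for suitable `n`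
(`IwasawaCF.exists_lasotaYorke`).

*Existence.* Consequently the averages of `H^(nk) 1` are bounded in variation. Along an ultrafilter
on `ℕ` they converge pointwise, the limit has bounded variation, and for functions of uniformly
bounded variation pointwise convergence along an ultrafilter implies convergence in `L¹`, since the
`L¹` norm is controlled by the values on a finite grid (`exists_tendsto_hyperfilter`). The limit is
fixed by `Hⁿ` and has nonzero integral; summing its images under `1, H, …, Hⁿ⁻¹` gives a fixed point
of `H`.

*Uniqueness.* Suppose `H f = z f` with `|z| = 1` and `f` of bounded variation. As `H` does not
increase the integral of `|f|`, there is no cancellation in the sum for `H f`, and the phase of `f`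
satisfies `phase (f x) = z · phase (f (T x))` almost everywhere on `{f ≠ 0}`. Given two continuity
points of `f` at which `f ≠ 0`, condition `(*)` provides points `x`, `x'` near these with
`Tᴺ x = Tᴺ x'`, so that the phases of `f x` and `f x'` agree. Hence the phase of `f` is constant,
which forces `z = 1` (`IwasawaCF.eigenfunction_eq_const_mul_norm`), and a fixed point with integral
zero vanishes, which makes the eigenspace one-dimensional. The powers of `H` are contractions of
`L¹`, so there are no Jordan blocks for the eigenvalue `1`.
-/

open Filter Topology

noncomputable section

/-! ### Functions of bounded variation on an interval -/

/-- Countable subadditivity of the variation. -/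
theorem eVariationOn_tsum_le {ι E : Type*} [NormedAddCommGroup E] {φ : ι → ℝ → E} {s : Set ℝ}
    (hs : ∀ x ∈ s, Summable fun i => φ i x) :
    eVariationOn (fun x => ∑' i, φ i x) s ≤ ∑' i, eVariationOn (φ i) s := by
  refine iSup_le ?_
  rintro ⟨n, u, hu, us⟩
  calc ∑ k ∈ Finset.range n, edist (∑' i, φ i (u (k + 1))) (∑' i, φ i (u k))
      ≤ ∑ k ∈ Finset.range n, ∑' i, edist (φ i (u (k + 1))) (φ i (u k)) := by
        refine Finset.sum_le_sum fun k _ => ?_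
        rw [edist_eq_enorm_sub, ← (hs _ (us _)).tsum_sub (hs _ (us _))]
        simp_rw [edist_eq_enorm_sub]
        exact enorm_tsum_le_tsum_enorm
    _ = ∑' i, ∑ k ∈ Finset.range n, edist (φ i (u (k + 1))) (φ i (u k)) :=
        (Summable.tsum_finsetSum fun _ _ => ENNReal.summable).symm
    _ ≤ _ := ENNReal.tsum_le_tsum fun i => eVariationOn.sum_le hu us

/-- Superadditivity of the variation over countably many non-overlapping intervals. -/
theorem tsum_eVariationOn_Icc_le {ι : Type*} (f : ℝ → ℂ) {a b : ℝ} {l r : ι → ℝ}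
    (hlr : ∀ i, l i < r i) (ha : ∀ i, a ≤ l i) (hb : ∀ i, r i ≤ b)
    (hd : Pairwise fun i j => Disjoint (Ioo (l i) (r i)) (Ioo (l j) (r j))) :
    ∑' i, eVariationOn f (Icc (l i) (r i)) ≤ eVariationOn f (Icc a b) := by
  classical
  rw [ENNReal.tsum_eq_iSup_sum]
  refine iSup_le fun t => ?_
  -- induction on the number of intervals, removing the rightmost one
  have key : ∀ B, (∀ i ∈ t, r i ≤ B) →
      ∑ i ∈ t, eVariationOn f (Icc (l i) (r i)) ≤ eVariationOn f (Icc a B) := by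
    induction t using Finset.induction_on_max_value l with
    | empty => simp
    | insert i t hi hmax ih =>
      intro B hB
      have h1 : ∀ j ∈ t, r j ≤ l i := by
        intro j hj
        have hne : j ≠ i := fun h => hi (h ▸ hj)
        have h2 : Disjoint (Ioo (l j) (r j)) (Ioo (l i) (r i)) := hd hne
        rw [Ioo_disjoint_Ioo] at h2
        rw [max_eq_right (hmax j hj)] at h2
        by_contra h3
        exact absurd (lt_min (not_le.1 h3) (hlr i)) (not_lt.2 h2)
      rw [Finset.sum_insert hi, add_comm]
      have h3 := ih (l i) h1
      have h4 : Icc a (l i) ∪ Icc (l i) (r i) ⊆ Icc a B := by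
        rw [Icc_union_Icc_eq_Icc (ha i) (hlr i).le]
        exact Icc_subset_Icc_right (hB i (by simp))
      calc _ ≤ eVariationOn f (Icc a (l i)) + eVariationOn f (Icc (l i) (r i)) := by gcongr
        _ ≤ _ := (eVariationOn.add_le_union f fun x hx y hy => hx.2.trans hy.1).trans
          (eVariationOn.mono f h4)
  exact key b fun i _ => hb i

/-- Cutting a bounded function off outside of an open interval adds at most two jumps to the
variation. -/
theorem eVariationOn_indicator_Ioo_le {k : ℝ → ℝ} {a b l r : ℝ} {D : ℝ} (hal : a ≤ l)
    (hlr : l < r) (hrb : r ≤ b) (hD : ∀ x ∈ Ioo l r, |k x| ≤ D) :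
    eVariationOn ((Ioo l r).indicator k) (Icc a b) ≤
      eVariationOn k (Ioo l r) + 2 * ENNReal.ofReal D := by
  rcases eq_or_ne (eVariationOn k (Ioo l r)) ∞ with htop | htop
  · simp [htop]
  set f := (Ioo l r).indicator k with hf
  have hfk : eVariationOn f (Ioo l r) = eVariationOn k (Ioo l r) :=
    eVariationOn.eq_of_eqOn fun x hx => by simp [hf, hx]
  have hbv : BoundedVariationOn f (Ioo l r) := by rwa [BoundedVariationOn, hfk]
  have hfl : f l = 0 := by simp [hf]
  have hfr : f r = 0 := by simp [hf]
  have hlim : ∀ {L : Filter ℝ} {c : ℝ}, L.NeBot → L ≤ 𝓟 (Ioo l r) → Tendsto f L (𝓝 c) →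
      edist 0 c ≤ ENNReal.ofReal D := by
    intro L c hL hLe hc
    rw [edist_comm, edist_zero_right, Real.enorm_eq_ofReal_abs]
    refine ENNReal.ofReal_le_ofReal (le_of_tendsto hc.abs ?_)
    filter_upwards [hLe (mem_principal_self _)] with x hx
    simpa [hf, hx] using hD x hx
  -- one-sided limits of `k` exist at both ends, and they are bounded by `D`
  have hIoc : eVariationOn f (Ioc l r) ≤ eVariationOn k (Ioo l r) + ENNReal.ofReal D := by
    obtain ⟨c, hc⟩ := hbv.exists_tendsto_left r
    have e1 : Ioo l r ∩ Iio r = Ioi l ∩ Iio r := by ext; simp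
    rw [e1] at hc
    have hN : (𝓝[Ioi l ∩ Iio r] r).NeBot := by
      rw [Ioi_inter_Iio]; exact right_nhdsWithin_Ioo_neBot hlr
    have h := eVariationOn.eVariationOn_on_inter_Iic_eq_Iio_add_edist (s := Ioi l) hN hlr hc
    rw [Ioi_inter_Iic, Ioi_inter_Iio, hfk, hfr] at h
    rw [h]
    gcongr
    refine hlim hN ?_ hc
    rw [Ioi_inter_Iio]
    exact inf_le_right
  have hIcc : eVariationOn f (Icc l r) ≤ eVariationOn k (Ioo l r) + 2 * ENNReal.ofReal D := by
    obtain ⟨c, hc⟩ := hbv.exists_tendsto_right l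
    have e1 : Ioo l r ∩ Ioi l = Iio r ∩ Ioi l := by ext; simp [and_comm]
    have e2 : 𝓝[Iio r ∩ Ioi l] l = 𝓝[Iic r ∩ Ioi l] l := by
      rw [inter_comm, Ioi_inter_Iio, inter_comm, Ioi_inter_Iic]
      rw [nhdsWithin_Ioo_eq_nhdsGT hlr, nhdsWithin_Ioc_eq_nhdsGT hlr]
    rw [e1] at hc
    have hN : (𝓝[Iic r ∩ Ioi l] l).NeBot := by
      rw [inter_comm, Ioi_inter_Iic, nhdsWithin_Ioc_eq_nhdsGT hlr]; infer_instance
    have h := eVariationOn.eVariationOn_on_inter_Ici_eq_Ioi_add_edist (s := Iic r) hN hlr.le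
      (e2 ▸ hc)
    rw [inter_comm, Ici_inter_Iic, inter_comm, Ioi_inter_Iic, hfl] at h
    rw [h, two_mul, ← add_assoc]
    gcongr
    refine hlim (e2 ▸ hN) ?_ hc
    rw [inter_comm, Ioi_inter_Iio]
    exact inf_le_right
  have h0 : ∀ s : Set ℝ, Disjoint s (Ioo l r) → eVariationOn f s = 0 := by
    intro s hs
    refine eVariationOn.constant_on fun x hx y hy => ?_
    obtain ⟨x, hx, rfl⟩ := hx
    obtain ⟨y, hy, rfl⟩ := hy
    simp only [hf]
    rw [indicator_of_notMem (hs.notMem_of_mem_left hx), indicator_of_notMem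
      (hs.notMem_of_mem_left hy)]
  have h1 := eVariationOn.Icc_add_Icc f (s := univ) hal (hlr.le.trans hrb) (mem_univ l)
  have h2 := eVariationOn.Icc_add_Icc f (s := univ) hlr.le hrb (mem_univ r)
  simp only [univ_inter] at h1 h2
  rw [← h1, ← h2, h0 (Icc a l), h0 (Icc r b), zero_add, add_zero]
  · exact hIcc
  · exact Set.disjoint_left.2 fun x hx hx' => not_lt.2 hx.1 hx'.2
  · exact Set.disjoint_left.2 fun x hx hx' => not_lt.2 hx.2 hx'.1

/-- A function of bounded variation on an interval, with values in an interval of length `σ`,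
has variation at most `4 σ` near each point: two jumps of size at most `σ`, and as much for the
variation off these. -/
theorem exists_nhds_eVariationOn_le {w : ℝ → ℝ} {a b σ : ℝ}
    (hw : BoundedVariationOn w (Icc a b)) (hσ : 0 < σ) (h0 : ∀ x, 0 ≤ w x)
    (h1 : ∀ x, w x ≤ σ) {x : ℝ} (hx : x ∈ Icc a b) :
    ∃ p q, p < x ∧ x < q ∧
      eVariationOn w (Icc a b ∩ Icc p q) ≤ ENNReal.ofReal (4 * σ) := by
  have hjump : ∀ {L : Filter ℝ} {c : ℝ}, L.NeBot → Tendsto w L (𝓝 c) →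
      edist (w x) c < ENNReal.ofReal (2 * σ) := by
    intro L c hL hc
    have c0 : 0 ≤ c := ge_of_tendsto' hc fun y => h0 y
    have c1 : c ≤ σ := le_of_tendsto' hc fun y => h1 y
    rw [edist_dist, Real.dist_eq]
    refine (ENNReal.ofReal_lt_ofReal_iff (by linarith)).2 ?_
    have := h0 x
    have := h1 x
    rw [abs_lt]; constructor <;> linarith
  have hleft : ∃ p < x, eVariationOn w (Icc a b ∩ Icc p x) ≤ ENNReal.ofReal (2 * σ) := by
    rcases hx.1.eq_or_lt with rfl | hax
    · refine ⟨a - 1, by linarith, ?_⟩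
      rw [eVariationOn.subsingleton]
      · exact zero_le
      · intro y hy z hz
        exact (le_antisymm hy.2.2 hy.1.1).trans (le_antisymm hz.2.2 hz.1.1).symm
    · obtain ⟨c, hc⟩ := hw.exists_tendsto_left x
      have e : Ico a x ⊆ Icc a b ∩ Iio x := fun y hy => ⟨⟨hy.1, hy.2.le.trans hx.2⟩, hy.2⟩
      have hN : (𝓝[Icc a b ∩ Iio x] x).NeBot :=
        (right_nhdsWithin_Ico_neBot hax).mono (nhdsWithin_mono _ e)
      have h := (hw.tendsto_eVariationOn_Icc_left hc hx).eventually (gt_mem_nhds (hjump hN hc))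
      obtain ⟨p, hp, hp'⟩ := (h.and self_mem_nhdsWithin).exists
      exact ⟨p, hp'.2, hp.le⟩
  have hright : ∃ q > x, eVariationOn w (Icc a b ∩ Icc x q) ≤ ENNReal.ofReal (2 * σ) := by
    rcases hx.2.eq_or_lt with rfl | hxb
    · refine ⟨x + 1, by linarith, ?_⟩
      rw [eVariationOn.subsingleton]
      · exact zero_le
      · intro y hy z hz
        exact (le_antisymm hy.1.2 hy.2.1).trans (le_antisymm hz.1.2 hz.2.1).symm
    · obtain ⟨c, hc⟩ := hw.exists_tendsto_right x
      have e : Ioc x b ⊆ Icc a b ∩ Ioi x := fun y hy => ⟨⟨hx.1.trans hy.1.le, hy.2⟩, hy.1⟩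
      have hN : (𝓝[Icc a b ∩ Ioi x] x).NeBot :=
        (left_nhdsWithin_Ioc_neBot hxb).mono (nhdsWithin_mono _ e)
      have h := (hw.tendsto_eVariationOn_Icc_right hc hx).eventually (gt_mem_nhds (hjump hN hc))
      obtain ⟨p, hp, hp'⟩ := (h.and self_mem_nhdsWithin).exists
      exact ⟨p, hp'.2, hp.le⟩
  obtain ⟨p, hp, hp'⟩ := hleft
  obtain ⟨q, hq, hq'⟩ := hright
  refine ⟨p, q, hp, hq, ?_⟩
  rw [← eVariationOn.Icc_add_Icc w hp.le hq.le hx, show 4 * σ = 2 * σ + 2 * σ by ring,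
    ENNReal.ofReal_add (by linarith) (by linarith)]
  gcongr

/-- A function is bounded by its value at one point plus its variation. -/
theorem enorm_le_add_eVariationOn (f : ℝ → ℂ) {s : Set ℝ} {x y : ℝ} (hx : x ∈ s) (hy : y ∈ s) :
    ‖f x‖ₑ ≤ ‖f y‖ₑ + eVariationOn f s := by
  calc ‖f x‖ₑ = ‖f y + (f x - f y)‖ₑ := by simp
    _ ≤ ‖f y‖ₑ + ‖f x - f y‖ₑ := enorm_add_le _ _
    _ ≤ _ := by
      gcongr
      rw [← edist_eq_enorm_sub]
      exact eVariationOn.edist_le f hx hy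

/-- A function is bounded by its mean modulus plus its variation. -/
theorem enorm_le_eVariationOn_add_mean {f : ℝ → ℂ} {c d x : ℝ} (hcd : c < d)
    (hx : x ∈ Icc c d) :
    ‖f x‖ₑ ≤ eVariationOn f (Icc c d) +
      (ENNReal.ofReal (d - c))⁻¹ * ∫⁻ y in Icc c d, ‖f y‖ₑ := by
  have hv : volume (Icc c d) = ENNReal.ofReal (d - c) := Real.volume_Icc
  have hv0 : ENNReal.ofReal (d - c) ≠ 0 := by simpa using hcd
  have h1 : ∫⁻ _ in Icc c d, ‖f x‖ₑ ≤
      ∫⁻ y in Icc c d, (‖f y‖ₑ + eVariationOn f (Icc c d)) := by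
    refine setLIntegral_mono' measurableSet_Icc fun y hy => ?_
    exact enorm_le_add_eVariationOn f hx hy
  rw [lintegral_add_right _ measurable_const] at h1
  simp only [lintegral_const, Measure.restrict_apply_univ, hv] at h1
  calc ‖f x‖ₑ = (ENNReal.ofReal (d - c))⁻¹ * (‖f x‖ₑ * ENNReal.ofReal (d - c)) := by
        rw [mul_comm, mul_assoc, ENNReal.mul_inv_cancel hv0 ENNReal.ofReal_ne_top, mul_one]
    _ ≤ (ENNReal.ofReal (d - c))⁻¹ * ((∫⁻ y in Icc c d, ‖f y‖ₑ) +
        eVariationOn f (Icc c d) * ENNReal.ofReal (d - c)) := by gcongr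
    _ = _ := by
      rw [mul_add, add_comm, mul_comm _ (_ * _), mul_assoc,
        ENNReal.mul_inv_cancel hv0 ENNReal.ofReal_ne_top, mul_one]

/-- The product estimate behind the Lasota–Yorke inequality: multiplication by a weight `w` with
values in `[0, σ]` shrinks the variation by the factor `5 σ`, up to a multiple of the
`L¹` norm. -/
theorem exists_eVariationOn_smul_le {w : ℝ → ℝ} {a b σ : ℝ} (hab : a ≤ b)
    (hw : BoundedVariationOn w (Icc a b)) (hσ : 0 < σ) (h0 : ∀ x, 0 ≤ w x)
    (h1 : ∀ x, w x ≤ σ) :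
    ∃ C : ℝ≥0∞, C ≠ ∞ ∧ ∀ f : ℝ → ℂ, eVariationOn (fun x => w x • f x) (Icc a b) ≤
      ENNReal.ofReal (5 * σ) * eVariationOn f (Icc a b) +
        C * ∫⁻ x in Icc a b, ‖f x‖ₑ := by
  choose p q hp hq hpq using fun x : Icc a b => exists_nhds_eVariationOn_le hw hσ h0 h1 x.2
  obtain ⟨t, ht0, htm, ⟨m, hm⟩, ht⟩ := exists_monotone_Icc_subset_open_cover_Icc hab
    (c := fun x : Icc a b => Subtype.val ⁻¹' Ioo (p x) (q x))
    (fun x => isOpen_Ioo.preimage continuous_subtype_val)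
    (fun x _ => mem_iUnion.2 ⟨x, hp x, hq x⟩)
  have hw' : ∀ n, eVariationOn w (Icc (t n : ℝ) (t (n + 1))) ≤ ENNReal.ofReal (4 * σ) := by
    intro n
    obtain ⟨x, hx⟩ := ht n
    refine (eVariationOn.mono w fun y hy => ?_).trans (hpq x)
    have hy' : y ∈ Icc a b := ⟨(t n).2.1.trans hy.1, hy.2.trans (t (n + 1)).2.2⟩
    have := @hx ⟨y, hy'⟩ hy
    exact ⟨hy', this.1.le, this.2.le⟩
  have hcell : ∀ n, ∃ C : ℝ≥0∞, C ≠ ∞ ∧ ∀ f : ℝ → ℂ,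
      eVariationOn (fun x => w x • f x) (Icc (t n : ℝ) (t (n + 1))) ≤
        ENNReal.ofReal (5 * σ) * eVariationOn f (Icc (t n : ℝ) (t (n + 1))) +
        C * ∫⁻ x in Icc a b, ‖f x‖ₑ := by
    intro n
    have hle : (t n : ℝ) ≤ t (n + 1) := htm n.le_succ
    rcases hle.eq_or_lt with he | hlt
    · refine ⟨0, by simp, fun f => ?_⟩
      rw [← he, eVariationOn.subsingleton _ (by simp)]
      exact zero_le
    · refine ⟨ENNReal.ofReal (4 * σ) * (ENNReal.ofReal (t (n + 1) - t n))⁻¹,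
        ENNReal.mul_ne_top ENNReal.ofReal_ne_top (by simpa using hlt), fun f => ?_⟩
      set K := Icc (t n : ℝ) (t (n + 1)) with hK
      have hKI : K ⊆ Icc a b := Icc_subset_Icc (t n).2.1 (t (n + 1)).2.2
      have h2 := eVariationOn_fun_smul_le (f := w) (g := f) (s := K) (C := ENNReal.ofReal σ)
        (D := eVariationOn f K + (ENNReal.ofReal (t (n + 1) - t n))⁻¹ * ∫⁻ y in K, ‖f y‖ₑ)
        (fun x _ => by
          rw [Real.enorm_eq_ofReal (h0 x)]
          exact ENNReal.ofReal_le_ofReal (h1 x))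
        (fun x hx => enorm_le_eVariationOn_add_mean hlt hx)
      refine h2.trans ?_
      calc _ ≤ ENNReal.ofReal σ * eVariationOn f K + (eVariationOn f K +
            (ENNReal.ofReal (t (n + 1) - t n))⁻¹ * ∫⁻ y in Icc a b, ‖f y‖ₑ) *
              ENNReal.ofReal (4 * σ) := by
            gcongr
            exact hw' n
        _ = _ := by
          rw [show 5 * σ = σ + 4 * σ by ring, ENNReal.ofReal_add hσ.le (by linarith)]
          ring
  choose C hC hCf using hcell
  refine ⟨∑ n ∈ Finset.range m, C n, ENNReal.sum_ne_top.2 fun n _ => hC n, fun f => ?_⟩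
  have hsum : ∀ g : ℝ → ℂ, ∑ n ∈ Finset.range m, eVariationOn g (Icc (t n : ℝ) (t (n + 1))) =
      eVariationOn g (Icc a b) := by
    intro g
    have := eVariationOn.sum' g (I := fun n => (t n : ℝ)) (fun i j h => htm h) (n := m)
    rw [this, ht0, hm m le_rfl]
  rw [← hsum, ← hsum, Finset.mul_sum, Finset.sum_mul, ← Finset.sum_add_distrib]
  exact Finset.sum_le_sum fun n _ => hCf n f

/-- Functions of bounded variation on an interval are almost everywhere measurable there. -/
theorem BoundedVariationOn.aestronglyMeasurable_complex {g : ℝ → ℂ} {s : Set ℝ}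
    (hs : MeasurableSet s) (hg : BoundedVariationOn g s) :
    AEStronglyMeasurable g (volume.restrict s) := by
  have key : ∀ f : ℝ → ℝ, BoundedVariationOn f s → AEMeasurable f (volume.restrict s) := by
    intro f hf
    obtain ⟨p, q, hp, hq, rfl⟩ := hf.locallyBoundedVariationOn.exists_monotoneOn_sub_monotoneOn
    exact (aemeasurable_restrict_of_monotoneOn hs hp).sub
      (aemeasurable_restrict_of_monotoneOn hs hq)
  have hre := key (Complex.re ∘ g) (ne_top_of_le_ne_top (ENNReal.mul_ne_top ENNReal.coe_ne_top hg)
    ((Complex.reCLM.lipschitz.lipschitzOnWith (s := univ)).comp_eVariationOn_le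
      (mapsTo_univ _ _)))
  have him := key (Complex.im ∘ g) (ne_top_of_le_ne_top (ENNReal.mul_ne_top ENNReal.coe_ne_top hg)
    ((Complex.imCLM.lipschitz.lipschitzOnWith (s := univ)).comp_eVariationOn_le
      (mapsTo_univ _ _)))
  exact (aemeasurable_of_re_im hre him).aestronglyMeasurable

/-! ### Grid estimates and the selection theorem -/

theorem eVariationOn_add_le (f g : ℝ → ℂ) (s : Set ℝ) :
    eVariationOn (f + g) s ≤ eVariationOn f s + eVariationOn g s := by
  refine iSup_le ?_
  rintro ⟨n, u, hu, us⟩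
  calc ∑ i ∈ Finset.range n, edist ((f + g) (u (i + 1))) ((f + g) (u i))
      ≤ ∑ i ∈ Finset.range n,
          (edist (f (u (i + 1))) (f (u i)) + edist (g (u (i + 1))) (g (u i))) :=
        Finset.sum_le_sum fun i _ => edist_add_add_le _ _ _ _
    _ = ∑ i ∈ Finset.range n, edist (f (u (i + 1))) (f (u i)) +
          ∑ i ∈ Finset.range n, edist (g (u (i + 1))) (g (u i)) := Finset.sum_add_distrib
    _ ≤ _ := add_le_add (eVariationOn.sum_le hu us) (eVariationOn.sum_le hu us)

theorem eVariationOn_const_smul_le (c : ℂ) (f : ℝ → ℂ) (s : Set ℝ) :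
    eVariationOn (c • f) s ≤ ‖c‖ₑ * eVariationOn f s :=
  ((lipschitzWith_smul c).lipschitzOnWith (s := univ)).comp_eVariationOn_le (mapsTo_univ f s)

theorem eVariationOn_sub_le (f g : ℝ → ℂ) (s : Set ℝ) :
    eVariationOn (f - g) s ≤ eVariationOn f s + eVariationOn g s := by
  have h := eVariationOn_const_smul_le (-1) g s
  rw [enorm_neg, enorm_one, one_mul] at h
  calc eVariationOn (f - g) s = eVariationOn (f + (-1 : ℂ) • g) s := by
        congr 1; simp [sub_eq_add_neg]
    _ ≤ _ := (eVariationOn_add_le _ _ _).trans (by gcongr)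

/-- The `L¹` norm of a function on an interval is controlled by its values on an equidistant grid
and its variation. -/
theorem lintegral_enorm_le_grid (g : ℝ → ℂ) {a b : ℝ} (hab : a < b) {N : ℕ} (hN : 0 < N) :
    ∫⁻ x in Icc a b, ‖g x‖ₑ ≤ ENNReal.ofReal ((b - a) / N) *
      (∑ j ∈ Finset.range N, ‖g (a + j * ((b - a) / N))‖ₑ + eVariationOn g (Icc a b)) := by
  set δ := (b - a) / N with hδ
  have hN' : (0 : ℝ) < N := by exact_mod_cast hN
  have hδ0 : 0 < δ := div_pos (sub_pos.2 hab) hN'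
  set x : ℕ → ℝ := fun j => a + j * δ with hx
  have hxm : Monotone x := by
    intro i j hij
    have : (i : ℝ) ≤ j := by exact_mod_cast hij
    simp only [hx]
    gcongr
  have hx0 : x 0 = a := by simp [hx]
  have hxN : x N = b := by simp only [hx, hδ]; field_simp; ring
  have hcover : ∀ n : ℕ, ∫⁻ y in Icc (x 0) (x n), ‖g y‖ₑ ≤
      ∑ j ∈ Finset.range n, ∫⁻ y in Icc (x j) (x (j + 1)), ‖g y‖ₑ := by
    intro n
    induction n with
    | zero => simp
    | succ n ih =>
      rw [Finset.sum_range_succ, ← Icc_union_Icc_eq_Icc (hxm (Nat.zero_le n)) (hxm n.le_succ)]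
      exact (lintegral_union_le _ _ _).trans (by gcongr)
  have hcell : ∀ j, ∫⁻ y in Icc (x j) (x (j + 1)), ‖g y‖ₑ ≤
      ENNReal.ofReal δ * (‖g (x j)‖ₑ + eVariationOn g (Icc (x j) (x (j + 1)))) := by
    intro j
    have hv : x (j + 1) - x j = δ := by simp only [hx]; push_cast; ring
    have h := setLIntegral_mono' (μ := volume) (measurableSet_Icc (a := x j) (b := x (j + 1)))
      fun y hy => enorm_le_add_eVariationOn g hy (left_mem_Icc.2 (hxm j.le_succ))
    rwa [lintegral_const, Measure.restrict_apply_univ, Real.volume_Icc, hv, mul_comm] at h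
  have h1 := hcover N
  have h2 := eVariationOn.sum' g hxm (n := N)
  rw [hx0, hxN] at h1 h2
  rw [← h2, ← Finset.sum_add_distrib, Finset.mul_sum]
  exact h1.trans (Finset.sum_le_sum fun j _ => hcell j)

/-- A form of Helly's selection theorem: a sequence that is bounded in variation and in `L¹`
converges in `L¹` along an ultrafilter to its pointwise limit, a function of bounded variation. -/
theorem exists_tendsto_hyperfilter {a b : ℝ} (hab : a < b) {u : ℕ → ℝ → ℂ} {V B : ℝ≥0∞}
    (hVtop : V ≠ ∞) (hBtop : B ≠ ∞) (hV : ∀ n, eVariationOn (u n) (Icc a b) ≤ V)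
    (hB : ∀ n, ∫⁻ x in Icc a b, ‖u n x‖ₑ ≤ B) :
    ∃ w : ℝ → ℂ, eVariationOn w (Icc a b) ≤ V ∧
      Tendsto (fun n => ∫⁻ x in Icc a b, ‖u n x - w x‖ₑ) (hyperfilter ℕ) (𝓝 0) := by
  set D := V + (ENNReal.ofReal (b - a))⁻¹ * B with hD
  have hDtop : D ≠ ∞ := by
    have : (ENNReal.ofReal (b - a))⁻¹ ≠ ∞ := by simpa using hab
    finiteness
  have hlim : ∀ x, ∃ c : ℂ, x ∈ Icc a b → Tendsto (fun n => u n x) (hyperfilter ℕ) (𝓝 c) := by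
    intro x
    by_cases hx : x ∈ Icc a b
    · have hmem : ∀ n, u n x ∈ Metric.closedBall (0 : ℂ) D.toReal := by
        intro n
        rw [mem_closedBall_zero_iff, ← toReal_enorm]
        refine ENNReal.toReal_mono hDtop ((enorm_le_eVariationOn_add_mean hab hx).trans ?_)
        exact add_le_add (hV n) (by gcongr; exact hB n)
      obtain ⟨c, -, hc⟩ := (isCompact_closedBall (0 : ℂ) D.toReal).ultrafilter_le_nhds'
        ((hyperfilter ℕ).map fun n => u n x) (Ultrafilter.mem_map.2 (univ_mem' hmem))
      exact ⟨c, fun _ => hc⟩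
    · exact ⟨0, fun h => absurd h hx⟩
  choose w hw using hlim
  have hwV : eVariationOn w (Icc a b) ≤ V := by
    by_contra! hlt
    obtain ⟨n, hn⟩ := (eVariationOn.lowerSemicontinuous_aux (F := u)
      (p := (hyperfilter ℕ : Filter ℕ)) (fun x hx => hw x hx) hlt).exists
    exact absurd hn (not_lt.2 (hV n))
  refine ⟨w, hwV, ENNReal.tendsto_nhds_zero.2 fun ε hε => ?_⟩
  have hmesh : Tendsto (fun N : ℕ => ENNReal.ofReal ((b - a) / N) * (0 + (V + V))) atTop
      (𝓝 0) := by
    have h1 : Tendsto (fun N : ℕ => ENNReal.ofReal ((b - a) / N)) atTop (𝓝 0) := by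
      have := ENNReal.tendsto_ofReal (tendsto_const_div_atTop_nhds_zero_nat (b - a))
      rwa [ENNReal.ofReal_zero] at this
    have := ENNReal.Tendsto.mul_const (b := 0 + (V + V)) h1 (Or.inr (by finiteness))
    rwa [zero_mul] at this
  obtain ⟨N, hNε, hN⟩ := ((hmesh.eventually (gt_mem_nhds hε)).and (eventually_gt_atTop 0)).exists
  have hN' : (0 : ℝ) < N := by exact_mod_cast hN
  have hδ : 0 < (b - a) / N := div_pos (sub_pos.2 hab) hN'
  have hgrid : Tendsto (fun n => ENNReal.ofReal ((b - a) / N) *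
      (∑ j ∈ Finset.range N, ‖u n (a + j * ((b - a) / N)) - w (a + j * ((b - a) / N))‖ₑ +
        (V + V))) (hyperfilter ℕ) (𝓝 (ENNReal.ofReal ((b - a) / N) * (0 + (V + V)))) := by
    refine ENNReal.Tendsto.const_mul (Tendsto.add ?_ tendsto_const_nhds)
      (Or.inr ENNReal.ofReal_ne_top)
    rw [← Finset.sum_const_zero (s := Finset.range N)]
    refine tendsto_finsetSum _ fun j hj => ?_
    have hj' : (j : ℝ) ≤ N := by exact_mod_cast (Finset.mem_range.1 hj).le
    have hxj : a + j * ((b - a) / N) ∈ Icc a b := by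
      constructor
      · have : 0 ≤ (j : ℝ) * ((b - a) / N) := by positivity
        linarith
      · have h1 : (j : ℝ) * ((b - a) / N) ≤ N * ((b - a) / N) := by gcongr
        have h2 : (N : ℝ) * ((b - a) / N) = b - a := by field_simp
        linarith
    have h := ((hw _ hxj).sub_const (w (a + j * ((b - a) / N)))).enorm
    rwa [sub_self, enorm_zero] at h
  filter_upwards [hgrid.eventually (gt_mem_nhds hNε)] with n hn
  refine le_trans ?_ hn.le
  refine (lintegral_enorm_le_grid (u n - w) hab hN).trans ?_
  gcongr
  · exact le_rfl
  · exact (eVariationOn_sub_le _ _ _).trans (add_le_add (hV n) hwV)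

/-! ### Equality in the triangle inequality -/

/-- Equality in the triangle inequality for series forces all terms to have the phase of the
sum. -/
theorem Complex.mul_norm_tsum_of_tsum_enorm_eq {ι : Type*} {w : ι → ℂ}
    (h : ∑' i, ‖w i‖ₑ = ‖∑' i, w i‖ₑ) (i : ι) :
    w i * ‖∑' j, w j‖ = ‖w i‖ * ∑' j, w j := by
  set W := ∑' j, w j with hW
  have htop : ∑' i, ‖w i‖ₑ ≠ ∞ := h ▸ enorm_ne_top
  have hnorm : Summable fun i => ‖w i‖ := by
    have := ENNReal.summable_toReal htop
    simpa using this
  have hsum : ∑' i, ‖w i‖ = ‖W‖ := by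
    have h1 := congrArg ENNReal.toReal h
    rw [ENNReal.tsum_toReal_eq fun i => enorm_ne_top] at h1
    simpa using h1
  have hw : HasSum w W := (hnorm.of_norm).hasSum
  have h1 : HasSum (fun i => ((starRingEnd ℂ) W * w i).re) (‖W‖ * ‖W‖) := by
    have h2 := Complex.hasSum_re (hw.mul_left ((starRingEnd ℂ) W))
    rwa [← Complex.normSq_eq_conj_mul_self, Complex.ofReal_re, Complex.normSq_eq_norm_sq,
      sq] at h2
  have h2 : HasSum (fun i => ‖W‖ * ‖w i‖ - ((starRingEnd ℂ) W * w i).re) 0 := by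
    have := ((hsum ▸ hnorm.hasSum).mul_left ‖W‖).sub h1
    rwa [sub_self] at this
  have hnn : ∀ i, 0 ≤ ‖W‖ * ‖w i‖ - ((starRingEnd ℂ) W * w i).re := by
    intro i
    have := Complex.re_le_norm ((starRingEnd ℂ) W * w i)
    rw [norm_mul, Complex.norm_conj] at this
    linarith
  have h3 : ‖W‖ * ‖w i‖ - ((starRingEnd ℂ) W * w i).re = 0 :=
    congrFun ((hasSum_zero_iff_of_nonneg hnn).1 h2) i
  have h4 : (starRingEnd ℂ) W * w i = ((‖W‖ * ‖w i‖ : ℝ) : ℂ) := by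
    have h5 : ‖(starRingEnd ℂ) W * w i‖ = ‖W‖ * ‖w i‖ := by rw [norm_mul, Complex.norm_conj]
    have h6 := (Complex.re_eq_norm (z := (starRingEnd ℂ) W * w i)).1 (by linarith)
    rw [Complex.eq_coe_norm_of_nonneg h6, h5]
  rcases eq_or_ne W 0 with h0 | h0
  · simp [h0]
  · have h5 : (‖W‖ : ℂ) ≠ 0 := by simpa using h0
    have h6 : W * (starRingEnd ℂ) W = (‖W‖ : ℂ) * ‖W‖ := by
      rw [Complex.mul_conj, Complex.normSq_eq_norm_sq]; push_cast; ring
    apply mul_left_cancel₀ h5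
    push_cast at h4
    linear_combination W * h4 - w i * h6

namespace IwasawaCF

/-! ### Inverse branches, weights, and the variation of the transfer operator -/

section Weights

variable {ι : Type*} (F : IwasawaCF ι)

/-- The bound `max |a| |b|` for the points of `I`; it is less than `1` for a proper map. -/
def bound : ℝ := max |F.a| |F.b|

theorem bound_nonneg : 0 ≤ F.bound := (abs_nonneg _).trans (le_max_left _ _)

theorem abs_le_bound {x : ℝ} (hx : x ∈ Icc F.a F.b) : |x| ≤ F.bound := by
  rw [abs_le]
  have h1 : |F.a| ≤ F.bound := le_max_left _ _
  have h2 : |F.b| ≤ F.bound := le_max_right _ _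
  rw [abs_le] at h1 h2
  exact ⟨h1.1.trans hx.1, hx.2.trans h2.2⟩

theorem sq_le_bound_sq {x : ℝ} (hx : x ∈ Icc F.a F.b) : x ^ 2 ≤ F.bound ^ 2 :=
  sq_le_sq' (abs_le.1 (F.abs_le_bound hx)).1 (abs_le.1 (F.abs_le_bound hx)).2

theorem bound_pos : 0 < F.bound := by
  refine F.bound_nonneg.lt_of_ne fun h => ?_
  have h1 := F.abs_le_bound (left_mem_Icc.2 F.a_lt_b.le)
  have h2 := F.abs_le_bound (right_mem_Icc.2 F.a_lt_b.le)
  rw [← h, abs_nonpos_iff] at h1 h2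
  exact F.a_lt_b.ne (h1.trans h2.symm)

theorem mul_pos_of_mem {i : ι} {x y : ℝ} (hx : x ∈ F.piece i) (hy : y ∈ F.piece i) :
    0 < x * y := by
  have h0 : F.r i ≤ 0 ∨ 0 ≤ F.l i := by
    have := F.zero_notMem i
    rw [mem_Ioo, not_and, not_lt] at this
    by_cases h : F.l i < 0
    · exact Or.inl (this h)
    · exact Or.inr (not_lt.1 h)
  rcases h0 with h | h
  · exact mul_pos_of_neg_of_neg (hx.2.trans_le h) (hy.2.trans_le h)
  · exact mul_pos (h.trans_lt hx.1) (h.trans_lt hy.1)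

theorem T_sub_T {i : ι} {x y : ℝ} (hx : x ∈ F.piece i) (hy : y ∈ F.piece i) :
    F.T x - F.T y = F.s i * ((y - x) / (x * y)) := by
  have := F.ne_zero_of_mem hx
  have := F.ne_zero_of_mem hy
  rw [F.T_eq i x hx, F.T_eq i y hy]
  field_simp
  ring

theorem inv_mem {i : ι} {y : ℝ} (hy : y ∈ F.dom i) : F.inv i y ∈ F.piece i :=
  F.inv_image i ▸ mem_image_of_mem _ hy

theorem inv_monotoneOn {i : ι} (h : F.s i = -1) : MonotoneOn (F.inv i) (F.dom i) := by
  rintro _ ⟨x, hx, rfl⟩ _ ⟨y, hy, rfl⟩ hxy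
  rw [F.inv_T hx, F.inv_T hy]
  by_contra! hlt
  have := F.T_sub_T hx hy
  have h2 := div_neg_of_neg_of_pos (sub_neg.2 hlt) (F.mul_pos_of_mem hx hy)
  rw [h] at this
  linarith

theorem inv_antitoneOn {i : ι} (h : F.s i = 1) : AntitoneOn (F.inv i) (F.dom i) := by
  rintro _ ⟨x, hx, rfl⟩ _ ⟨y, hy, rfl⟩ hxy
  rw [F.inv_T hx, F.inv_T hy]
  by_contra! hlt
  have := F.T_sub_T hx hy
  have h2 := div_pos (sub_pos.2 hlt) (F.mul_pos_of_mem hx hy)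
  rw [h] at this
  linarith

theorem abs_deriv_inv (i : ι) (y : ℝ) : |deriv (F.inv i) y| = F.inv i y ^ 2 := by
  have h1 : F.inv i = fun y => F.s i * (y - F.c i)⁻¹ := by
    funext y; rw [inv, div_eq_mul_inv]
  have h2 : deriv (F.inv i) y = F.s i * -((y - F.c i) ^ 2)⁻¹ := by
    rw [h1, deriv_const_mul_field, deriv_comp_sub_const (f := fun z : ℝ => z⁻¹), deriv_inv]
  have hs : |F.s i| = 1 := by rcases F.sign i with h | h <;> simp [h]
  have hs2 : F.s i ^ 2 = 1 := by rw [← sq_abs, hs, one_pow]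
  rw [h2, abs_mul, hs, one_mul, abs_neg, abs_of_nonneg (by positivity), inv, div_pow, hs2,
    one_div]

theorem term_of_mem (f : ℝ → ℂ) {i : ι} {y : ℝ} (hy : y ∈ F.dom i) :
    F.term f i y = F.inv i y ^ 2 • f (F.inv i y) := by
  rw [term, indicator_of_mem hy, abs_deriv_inv, Complex.real_smul]

theorem term_of_notMem (f : ℝ → ℂ) {i : ι} {y : ℝ} (hy : y ∉ F.dom i) :
    F.term f i y = 0 := by
  rw [term, indicator_of_notMem hy]

/-- The union of the open pieces, on which `T` is given by inversions. -/
def pieces : Set ℝ := ⋃ i, F.piece i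

theorem pieces_subset : F.pieces ⊆ Icc F.a F.b := iUnion_subset F.piece_subset

theorem piece_subset_pieces (i : ι) : F.piece i ⊆ F.pieces := subset_iUnion _ i

theorem l_notMem_pieces (i : ι) : F.l i ∉ F.pieces := by
  rw [pieces, mem_iUnion]
  rintro ⟨j, hj⟩
  have hne : i ≠ j := by rintro rfl; exact lt_irrefl _ hj.1
  have h : Disjoint (Ioo (F.l i) (F.r i)) (Ioo (F.l j) (F.r j)) := F.pairwise_disjoint hne
  rw [Ioo_disjoint_Ioo, max_eq_left hj.1.le] at h
  exact absurd (lt_min (F.l_lt_r i) hj.2) (not_lt.2 h)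

theorem r_notMem_pieces (i : ι) : F.r i ∉ F.pieces := by
  rw [pieces, mem_iUnion]
  rintro ⟨j, hj⟩
  have hne : i ≠ j := by rintro rfl; exact lt_irrefl _ hj.2
  have h : Disjoint (Ioo (F.l i) (F.r i)) (Ioo (F.l j) (F.r j)) := F.pairwise_disjoint hne
  rw [Ioo_disjoint_Ioo, min_eq_left hj.2.le] at h
  exact absurd (max_lt (F.l_lt_r i) hj.1) (not_lt.2 h)

/-- The weight `1 / |(Tⁿ)'|` of the `n`-th iterate, set to `0` off the `n`-cylinders. -/
def weight : ℕ → ℝ → ℝ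
  | 0 => fun _ => 1
  | n + 1 => F.pieces.indicator fun x => x ^ 2 * weight n (F.T x)

theorem weight_nonneg (n : ℕ) : ∀ x, 0 ≤ F.weight n x := by
  induction n with
  | zero => intro x; simp [weight]
  | succ n ih =>
    intro x
    exact indicator_nonneg (fun x _ => mul_nonneg (sq_nonneg x) (ih _)) x

theorem weight_le (n : ℕ) : ∀ x, F.weight n x ≤ (F.bound ^ 2) ^ n := by
  induction n with
  | zero => intro x; simp [weight]
  | succ n ih =>
    intro x
    by_cases hx : x ∈ F.pieces
    · rw [weight, indicator_of_mem hx, pow_succ' (F.bound ^ 2) n]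
      exact mul_le_mul (F.sq_le_bound_sq (F.pieces_subset hx)) (ih _) (F.weight_nonneg n _)
        (sq_nonneg _)
    · rw [weight, indicator_of_notMem hx]
      positivity

theorem weight_one_of_mem {x : ℝ} (hx : x ∈ F.pieces) : F.weight 1 x = x ^ 2 := by
  simp [weight, hx]

theorem weight_of_notMem (n : ℕ) {x : ℝ} (hx : x ∉ F.pieces) : F.weight (n + 1) x = 0 := by
  simp [weight, hx]

theorem weight_succ (n : ℕ) (x : ℝ) : F.weight (n + 1) x = F.weight 1 x * F.weight n (F.T x) := by
  by_cases hx : x ∈ F.pieces <;> simp [weight, hx]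

/-- Each term of the transfer operator is a monotone or antitone reparametrization of
`x² f(x)` on one piece, extended by `0`. -/
theorem exists_term_eq_comp (f : ℝ → ℂ) (i : ι) : ∃ ψ : ℝ → ℝ,
    (Monotone ψ ∨ Antitone ψ) ∧ (∀ y, ψ y ∈ Icc (F.l i) (F.r i)) ∧
      F.term f i = (fun x => F.weight 1 x • f x) ∘ ψ := by
  obtain ⟨d, e, hde, -⟩ := F.share i
  have hdom : F.dom i = Ioo d e := hde
  have hlr := (F.l_lt_r i).le
  -- the values `u`, `v` at the two ends are endpoints of the piece, where the weight vanishes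
  have key : ∀ u v : ℝ, (u = F.l i ∨ u = F.r i) → (v = F.l i ∨ v = F.r i) →
      let ψ : ℝ → ℝ := fun y => if y ≤ d then u else if y < e then F.inv i y else v
      (∀ y, ψ y ∈ Icc (F.l i) (F.r i)) ∧
      F.term f i = (fun x => F.weight 1 x • f x) ∘ ψ := by
    intro u v hu hv ψ
    have hz : ∀ w, (w = F.l i ∨ w = F.r i) → F.weight 1 w = 0 ∧ w ∈ Icc (F.l i) (F.r i) := by
      rintro w (rfl | rfl)
      · exact ⟨F.weight_of_notMem 0 (F.l_notMem_pieces i), left_mem_Icc.2 hlr⟩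
      · exact ⟨F.weight_of_notMem 0 (F.r_notMem_pieces i), right_mem_Icc.2 hlr⟩
    refine ⟨fun y => ?_, funext fun y => ?_⟩
    · simp only [ψ]
      split_ifs with h1 h2
      · exact (hz u hu).2
      · exact Ioo_subset_Icc_self (F.inv_mem (hdom ▸ ⟨not_le.1 h1, h2⟩))
      · exact (hz v hv).2
    · simp only [ψ, Function.comp]
      split_ifs with h1 h2
      · rw [F.term_of_notMem f (by rw [hdom]; exact fun h => not_lt.2 h1 h.1), (hz u hu).1,
          zero_smul]
      · have hy : y ∈ F.dom i := hdom ▸ ⟨not_le.1 h1, h2⟩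
        rw [F.term_of_mem f hy, F.weight_one_of_mem (F.piece_subset_pieces i (F.inv_mem hy))]
      · rw [F.term_of_notMem f (by rw [hdom]; exact fun h => h2 h.2), (hz v hv).1,
          zero_smul]
  have hmem : ∀ y, ¬ y ≤ d → y < e → F.inv i y ∈ Ioo (F.l i) (F.r i) :=
    fun y h1 h2 => F.inv_mem (hdom ▸ ⟨not_le.1 h1, h2⟩)
  rcases F.sign i with hs | hs
  · obtain ⟨h1, h2⟩ := key (F.r i) (F.l i) (Or.inr rfl) (Or.inl rfl)
    refine ⟨_, Or.inr ?_, h1, h2⟩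
    have hmono := F.inv_antitoneOn hs
    rw [hdom] at hmono
    intro y z hyz
    dsimp only
    split_ifs <;> first
      | linarith
      | exact (hmem _ (by assumption) (by assumption)).2.le
      | exact (hmem _ (by assumption) (by assumption)).1.le
      | exact hmono ⟨not_le.1 (by assumption), by assumption⟩
          ⟨not_le.1 (by assumption), by assumption⟩ hyz
  · obtain ⟨h1, h2⟩ := key (F.l i) (F.r i) (Or.inl rfl) (Or.inr rfl)
    refine ⟨_, Or.inl ?_, h1, h2⟩
    have hmono := F.inv_monotoneOn hs
    rw [hdom] at hmono
    intro y z hyz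
    dsimp only
    split_ifs <;> first
      | linarith
      | exact (hmem _ (by assumption) (by assumption)).2.le
      | exact (hmem _ (by assumption) (by assumption)).1.le
      | exact hmono ⟨not_le.1 (by assumption), by assumption⟩
          ⟨not_le.1 (by assumption), by assumption⟩ hyz

theorem eVariationOn_term_le (f : ℝ → ℂ) (i : ι) (s : Set ℝ) :
    eVariationOn (F.term f i) s ≤
      eVariationOn (fun x => F.weight 1 x • f x) (Icc (F.l i) (F.r i)) := by
  obtain ⟨ψ, hψ, hm, he⟩ := F.exists_term_eq_comp f i
  rw [he]
  rcases hψ with h | h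
  · exact eVariationOn.comp_le_of_monotoneOn _ _ (h.monotoneOn s) fun y _ => hm y
  · exact eVariationOn.comp_le_of_antitoneOn _ _ (h.antitoneOn s) fun y _ => hm y

theorem enorm_term_le (f : ℝ → ℂ) (i : ι) (y : ℝ) :
    ‖F.term f i y‖ₑ ≤
      eVariationOn (fun x => F.weight 1 x • f x) (Icc (F.l i) (F.r i)) := by
  obtain ⟨ψ, hψ, hm, he⟩ := F.exists_term_eq_comp f i
  have h := eVariationOn.edist_le (fun x => F.weight 1 x • f x) (hm y)
    (left_mem_Icc.2 (F.l_lt_r i).le)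
  rw [F.weight_of_notMem 0 (F.l_notMem_pieces i), zero_smul, edist_zero_right] at h
  rwa [he]

theorem tsum_eVariationOn_weight_smul_le (f : ℝ → ℂ) :
    ∑' i, eVariationOn (fun x => F.weight 1 x • f x) (Icc (F.l i) (F.r i)) ≤
      eVariationOn (fun x => F.weight 1 x • f x) (Icc F.a F.b) :=
  tsum_eVariationOn_Icc_le _ F.l_lt_r F.a_le_l F.r_le_b F.pairwise_disjoint

/-- The transfer operator does not increase the variation of `f / |T'|`, where this function is
set to `0` at the ends of the pieces. -/
theorem eVariationOn_transferFun_le (f : ℝ → ℂ) :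
    eVariationOn (F.transferFun f) (Icc F.a F.b) ≤
      eVariationOn (fun x => F.weight 1 x • f x) (Icc F.a F.b) := by
  rcases eq_or_ne (eVariationOn (fun x => F.weight 1 x • f x) (Icc F.a F.b)) ∞ with h | h
  · rw [h]
    exact le_top
  have hs : ∀ y, Summable fun i => F.term f i y := by
    intro y
    refine Summable.of_enorm ?_
    exact ne_top_of_le_ne_top h ((ENNReal.tsum_le_tsum fun i => F.enorm_term_le f i y).trans
      (F.tsum_eVariationOn_weight_smul_le f))
  calc eVariationOn (F.transferFun f) (Icc F.a F.b)
      ≤ ∑' i, eVariationOn (F.term f i) (Icc F.a F.b) := eVariationOn_tsum_le fun y _ => hs y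
    _ ≤ _ := (ENNReal.tsum_le_tsum fun i => F.eVariationOn_term_le f i _).trans
      (F.tsum_eVariationOn_weight_smul_le f)

theorem transferFun_comp_T_smul (w : ℝ → ℝ) (f : ℝ → ℂ) :
    F.transferFun (fun x => w (F.T x) • f x) = fun y => w y • F.transferFun f y := by
  funext y
  rw [transferFun, transferFun, ← tsum_const_smul'']
  refine tsum_congr fun i => ?_
  by_cases hy : y ∈ F.dom i
  · rw [F.term_of_mem _ hy, F.term_of_mem _ hy, F.T_inv hy, smul_comm]
  · rw [F.term_of_notMem _ hy, F.term_of_notMem _ hy, smul_zero]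

theorem eVariationOn_transferFun_iterate_le (n : ℕ) : ∀ f : ℝ → ℂ,
    eVariationOn (F.transferFun^[n] f) (Icc F.a F.b) ≤
      eVariationOn (fun x => F.weight n x • f x) (Icc F.a F.b) := by
  induction n with
  | zero => intro f; simp [weight]
  | succ n ih =>
    intro f
    rw [Function.iterate_succ_apply]
    refine (ih _).trans ?_
    rw [← F.transferFun_comp_T_smul]
    refine (F.eVariationOn_transferFun_le _).trans (le_of_eq ?_)
    congr 1
    funext x
    rw [F.weight_succ n x, mul_smul]

end Weights

/-! ### Bounded variation of the weights and the Lasota–Yorke inequality -/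

section LasotaYorke

variable {ι : Type*} (F : IwasawaCF ι)

theorem T_monotoneOn_or_antitoneOn (i : ι) :
    MonotoneOn F.T (F.piece i) ∨ AntitoneOn F.T (F.piece i) := by
  rcases F.sign i with hs | hs
  · refine Or.inr fun x hx y hy hxy => ?_
    have h1 := F.T_sub_T hx hy
    have h2 := div_nonneg (sub_nonneg.2 hxy) (F.mul_pos_of_mem hx hy).le
    rw [hs] at h1
    linarith
  · refine Or.inl fun x hx y hy hxy => ?_
    have h1 := F.T_sub_T hx hy
    have h2 := div_nonneg (sub_nonneg.2 hxy) (F.mul_pos_of_mem hx hy).le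
    rw [hs] at h1
    linarith

/-- Bounded distortion: on a full piece, `x²` is at most a constant times the length of the
piece. -/
theorem sq_le_mul_length {i : ι} (hl : F.l i ≠ F.a) (hr : F.r i ≠ F.b) {x : ℝ}
    (hx : x ∈ F.piece i) :
    x ^ 2 ≤ (1 + (F.b - F.a) * F.bound) ^ 2 * (2 / (F.b - F.a)) * (F.r i - F.l i) := by
  have hab := F.a_lt_b
  have hfull : F.T '' F.piece i = Ioo F.a F.b := F.full i hl hr
  set L := F.b - F.a with hL
  have hLpos : 0 < L := sub_pos.2 hab
  -- two points whose images are at distance `L / 2`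
  obtain ⟨x₁, hx₁, h₁⟩ : F.a + L / 4 ∈ F.T '' F.piece i := by
    rw [hfull]; constructor <;> linarith
  obtain ⟨x₂, hx₂, h₂⟩ : F.b - L / 4 ∈ F.T '' F.piece i := by
    rw [hfull]; constructor <;> linarith
  -- the ratio of two points of the piece is bounded
  have key : ∀ u ∈ F.piece i, |x| ≤ (1 + L * F.bound) * |u| := by
    intro u hu
    have hTx : F.T x ∈ Ioo F.a F.b := hfull ▸ mem_image_of_mem _ hx
    have hTu : F.T u ∈ Ioo F.a F.b := hfull ▸ mem_image_of_mem _ hu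
    have h1 : |F.T x - F.T u| ≤ L := by
      rw [abs_le]; constructor <;> linarith [hTx.1, hTx.2, hTu.1, hTu.2]
    have hs : |F.s i| = 1 := by rcases F.sign i with h | h <;> simp [h]
    have hxu := F.mul_pos_of_mem hx hu
    rw [F.T_sub_T hx hu, abs_mul, hs, one_mul, abs_div, abs_of_pos hxu, div_le_iff₀ hxu] at h1
    have h2 : x * u = |x| * |u| := by rw [← abs_mul, abs_of_pos hxu]
    have h3 : |x| ≤ |u| + |u - x| := by
      have := abs_sub_abs_le_abs_sub x u
      rw [abs_sub_comm x u] at this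
      linarith
    have h4 := F.abs_le_bound (F.piece_subset i hx)
    have h5 : L * (|x| * |u|) ≤ L * (F.bound * |u|) := by gcongr
    rw [h2] at h1
    linarith
  have h12 := F.T_sub_T hx₂ hx₁
  have hpos := F.mul_pos_of_mem hx₂ hx₁
  have h3 : x₂ * x₁ * (L / 2) ≤ F.r i - F.l i := by
    have hs : |F.s i| = 1 := by rcases F.sign i with h | h <;> simp [h]
    have h4 : |F.T x₂ - F.T x₁| = L / 2 := by
      rw [h₁, h₂, abs_of_pos (by linarith)]; linarith
    rw [h12, abs_mul, hs, one_mul, abs_div, abs_of_pos hpos, div_eq_iff hpos.ne'] at h4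
    have h5 : |x₁ - x₂| ≤ F.r i - F.l i := by
      rw [abs_le]; constructor <;> linarith [hx₁.1, hx₁.2, hx₂.1, hx₂.2]
    linarith
  have hD : 0 ≤ 1 + L * F.bound := by have := F.bound_nonneg; positivity
  calc x ^ 2 = |x| * |x| := by rw [← sq, sq_abs]
    _ ≤ ((1 + L * F.bound) * |x₂|) * ((1 + L * F.bound) * |x₁|) :=
      mul_le_mul (key x₂ hx₂) (key x₁ hx₁) (abs_nonneg _) (by positivity)
    _ = (1 + L * F.bound) ^ 2 * (2 / L) * (x₂ * x₁ * (L / 2)) := by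
      have h6 : x₂ * x₁ = |x₂| * |x₁| := by rw [← abs_mul, abs_of_pos hpos]
      rw [h6]
      field_simp
    _ ≤ _ := by gcongr

theorem tsum_indicator_subsingleton_ne_top {S : Set ι} (hS : S.Subsingleton) {c : ℝ≥0∞}
    (hc : c ≠ ∞) : ∑' i, S.indicator (fun _ => c) i ≠ ∞ := by
  rcases hS.eq_empty_or_singleton with rfl | ⟨j, rfl⟩
  · simp
  · rw [tsum_eq_single j fun i hi => by simp [hi]]
    simpa using hc

theorem subsingleton_l_eq (x : ℝ) : {i | F.l i = x}.Subsingleton := by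
  intro i hi j hj
  by_contra hne
  have h : Disjoint (Ioo (F.l i) (F.r i)) (Ioo (F.l j) (F.r j)) := F.pairwise_disjoint hne
  rw [mem_ofPred_eq] at hi hj
  rw [Ioo_disjoint_Ioo, hi, hj, max_self] at h
  exact absurd (lt_min (hi ▸ F.l_lt_r i) (hj ▸ F.l_lt_r j)) (not_lt.2 h)

theorem subsingleton_r_eq (x : ℝ) : {i | F.r i = x}.Subsingleton := by
  intro i hi j hj
  by_contra hne
  have h : Disjoint (Ioo (F.l i) (F.r i)) (Ioo (F.l j) (F.r j)) := F.pairwise_disjoint hne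
  rw [mem_ofPred_eq] at hi hj
  rw [Ioo_disjoint_Ioo, hi, hj, min_self] at h
  exact absurd (max_lt (hi ▸ F.l_lt_r i) (hj ▸ F.l_lt_r j)) (not_lt.2 h)

theorem tsum_length_ne_top [Countable ι] :
    ∑' i, ENNReal.ofReal (F.r i - F.l i) ≠ ∞ := by
  have h1 : ∑' i, ENNReal.ofReal (F.r i - F.l i) = volume F.pieces := by
    have hd : Pairwise (Function.onFun Disjoint F.piece) := F.pairwise_disjoint
    rw [pieces, measure_iUnion hd fun i => measurableSet_Ioo]
    simp [piece]
  rw [h1]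
  exact ((measure_mono F.pieces_subset).trans_lt (by simp [Real.volume_Icc])).ne

/-- The suprema of `1 / |T'| = x²` over the pieces are summable. -/
theorem exists_summable_sq_bound [Countable ι] : ∃ A : ι → ℝ, (∀ i, 0 ≤ A i) ∧
    (∀ i, ∀ x ∈ F.piece i, x ^ 2 ≤ A i) ∧ ∑' i, ENNReal.ofReal (A i) ≠ ∞ := by
  classical
  set C := (1 + (F.b - F.a) * F.bound) ^ 2 * (2 / (F.b - F.a)) with hC
  have hL : 0 < F.b - F.a := sub_pos.2 F.a_lt_b
  have hC0 : 0 ≤ C := by positivity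
  have hlen : ∀ i, 0 ≤ F.r i - F.l i := fun i => (sub_pos.2 (F.l_lt_r i)).le
  let S : Set ι := {i | F.l i = F.a}
  let S' : Set ι := {i | F.r i = F.b}
  have hSn : ∀ (U : Set ι) i, 0 ≤ U.indicator (fun _ => F.bound ^ 2) i := fun U i =>
    indicator_nonneg (fun _ _ => sq_nonneg _) i
  have hind : ∀ (U : Set ι) i, ENNReal.ofReal (U.indicator (fun _ => F.bound ^ 2) i) =
      U.indicator (fun _ => ENNReal.ofReal (F.bound ^ 2)) i := by
    intro U i
    by_cases hi : i ∈ U <;> simp [hi]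
  -- the supremum over a full piece is at most `C` times its length; the pieces at the two ends of
  -- `I`, which need not be full, are counted separately
  refine ⟨fun i => S.indicator (fun _ => F.bound ^ 2) i + S'.indicator (fun _ => F.bound ^ 2) i +
    C * (F.r i - F.l i), fun i => ?_, fun i x hx => ?_, ?_⟩
  · exact add_nonneg (add_nonneg (hSn _ _) (hSn _ _)) (mul_nonneg hC0 (hlen i))
  · have h1 := F.sq_le_bound_sq (F.piece_subset i hx)
    have h2 := hSn S i
    have h3 := hSn S' i
    have h4 := mul_nonneg hC0 (hlen i)
    by_cases hl : F.l i = F.a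
    · have : S.indicator (fun _ => F.bound ^ 2) i = F.bound ^ 2 :=
        indicator_of_mem (show i ∈ S from hl) _
      dsimp only
      linarith
    · by_cases hr : F.r i = F.b
      · have : S'.indicator (fun _ => F.bound ^ 2) i = F.bound ^ 2 :=
          indicator_of_mem (show i ∈ S' from hr) _
        dsimp only
        linarith
      · have := F.sq_le_mul_length hl hr hx
        dsimp only
        linarith
  · have h1 : ∀ i, ENNReal.ofReal (S.indicator (fun _ => F.bound ^ 2) i +
        S'.indicator (fun _ => F.bound ^ 2) i + C * (F.r i - F.l i)) =
        S.indicator (fun _ => ENNReal.ofReal (F.bound ^ 2)) i +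
        S'.indicator (fun _ => ENNReal.ofReal (F.bound ^ 2)) i +
        ENNReal.ofReal C * ENNReal.ofReal (F.r i - F.l i) := by
      intro i
      rw [ENNReal.ofReal_add (add_nonneg (hSn _ _) (hSn _ _)) (mul_nonneg hC0 (hlen i)),
        ENNReal.ofReal_add (hSn _ _) (hSn _ _), ENNReal.ofReal_mul hC0, hind, hind]
    simp_rw [h1]
    rw [ENNReal.tsum_add, ENNReal.tsum_add, ENNReal.tsum_mul_left]
    exact ENNReal.add_ne_top.2 ⟨ENNReal.add_ne_top.2
      ⟨tsum_indicator_subsingleton_ne_top (F.subsingleton_l_eq _) ENNReal.ofReal_ne_top,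
        tsum_indicator_subsingleton_ne_top (F.subsingleton_r_eq _) ENNReal.ofReal_ne_top⟩,
      ENNReal.mul_ne_top ENNReal.ofReal_ne_top F.tsum_length_ne_top⟩

theorem eVariationOn_sq_le (i : ι) : eVariationOn (fun x : ℝ => x ^ 2) (F.piece i) ≤
    ENNReal.ofReal (2 * F.bound) * ENNReal.ofReal (F.r i - F.l i) := by
  have h1 : LipschitzOnWith (2 * F.bound).toNNReal (fun x : ℝ => x ^ 2) (F.piece i) := by
    refine LipschitzOnWith.of_dist_le_mul fun x hx y hy => ?_
    have hx' := abs_le.1 (F.abs_le_bound (F.piece_subset i hx))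
    have hy' := abs_le.1 (F.abs_le_bound (F.piece_subset i hy))
    rw [Real.coe_toNNReal _ (by linarith [F.bound_nonneg]), Real.dist_eq, Real.dist_eq, sq_sub_sq,
      abs_mul]
    gcongr
    rw [abs_le]; constructor <;> linarith
  have h2 := h1.comp_eVariationOn_le (g := id) (s := F.piece i) (mapsTo_id _)
  refine h2.trans (mul_le_mul_right ?_ _)
  have h3 : MonotoneOn (id : ℝ → ℝ) univ := monotone_id.monotoneOn _
  have h4 := h3.eVariationOn_eq (mem_univ (F.l i)) (mem_univ (F.r i))
  have h5 : F.piece i ⊆ univ ∩ Icc (F.l i) (F.r i) :=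
    fun x hx => ⟨mem_univ _, hx.1.le, hx.2.le⟩
  exact (eVariationOn.mono _ h5).trans h4.le

/-- The weights of the iterates have bounded variation. -/
theorem boundedVariationOn_weight [Countable ι] (n : ℕ) :
    BoundedVariationOn (F.weight n) (Icc F.a F.b) := by
  induction n with
  | zero =>
    have : eVariationOn (F.weight 0) (Icc F.a F.b) = 0 :=
      eVariationOn.constant_on (by rintro _ ⟨x, -, rfl⟩ _ ⟨y, -, rfl⟩; rfl)
    rw [BoundedVariationOn, this]
    simp
  | succ n ih =>
    obtain ⟨A, hA0, hA, hAsum⟩ := F.exists_summable_sq_bound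
    set k : ℝ → ℝ := fun x => x ^ 2 * F.weight n (F.T x) with hk
    set W := (F.bound ^ 2) ^ n with hW
    have hW0 : 0 ≤ W := by positivity
    set V := eVariationOn (F.weight n) (Icc F.a F.b) with hV
    have hsingle : ∀ x, HasSum (fun i => (F.piece i).indicator k x) (F.weight (n + 1) x) := by
      intro x
      by_cases hx : x ∈ F.pieces
      · obtain ⟨i, hi⟩ := mem_iUnion.1 hx
        have h1 : F.weight (n + 1) x = (F.piece i).indicator k x := by
          simp [weight, hx, hi, hk]
        rw [h1]
        refine hasSum_single i fun j hj => indicator_of_notMem (fun hxj => ?_) _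
        exact (F.pairwise_disjoint hj).notMem_of_mem_left hxj hi
      · rw [F.weight_of_notMem n hx]
        convert hasSum_zero using 2 with i
        exact indicator_of_notMem (fun h => hx (F.piece_subset_pieces i h)) _
    have hfun : F.weight (n + 1) = fun x => ∑' i, (F.piece i).indicator k x :=
      funext fun x => (hsingle x).tsum_eq.symm
    have hpiece : ∀ i, eVariationOn ((F.piece i).indicator k) (Icc F.a F.b) ≤
        ENNReal.ofReal (A i) * V + ENNReal.ofReal W * (ENNReal.ofReal (2 * F.bound) *
          ENNReal.ofReal (F.r i - F.l i)) + 2 * (ENNReal.ofReal (A i) * ENNReal.ofReal W) := by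
      intro i
      have h1 : ∀ x ∈ Ioo (F.l i) (F.r i), |k x| ≤ A i * W := by
        intro x hx
        rw [hk, abs_of_nonneg (mul_nonneg (sq_nonneg x) (F.weight_nonneg n _))]
        exact mul_le_mul (hA i x hx) (F.weight_le n _) (F.weight_nonneg n _) (hA0 i)
      refine (eVariationOn_indicator_Ioo_le (F.a_le_l i) (F.l_lt_r i) (F.r_le_b i) h1).trans ?_
      rw [ENNReal.ofReal_mul (hA0 i)]
      gcongr
      have h2 := eVariationOn_fun_smul_le (f := fun x : ℝ => x ^ 2)
        (g := fun x => F.weight n (F.T x)) (s := F.piece i) (C := ENNReal.ofReal (A i))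
        (D := ENNReal.ofReal W)
        (fun x hx => by
          rw [Real.enorm_eq_ofReal (sq_nonneg x)]
          exact ENNReal.ofReal_le_ofReal (hA i x hx))
        (fun x hx => by
          rw [Real.enorm_eq_ofReal (F.weight_nonneg n _)]
          exact ENNReal.ofReal_le_ofReal (F.weight_le n _))
      refine h2.trans ?_
      have hmaps : MapsTo F.T (F.piece i) (Icc F.a F.b) := fun x hx =>
        F.mapsTo (F.piece_subset i hx)
      have h3 : eVariationOn (fun x => F.weight n (F.T x)) (F.piece i) ≤ V := by
        rcases F.T_monotoneOn_or_antitoneOn i with h | h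
        · exact eVariationOn.comp_le_of_monotoneOn (F.weight n) F.T h hmaps
        · exact eVariationOn.comp_le_of_antitoneOn (F.weight n) F.T h hmaps
      gcongr
      exact F.eVariationOn_sq_le i
    rw [BoundedVariationOn, hfun]
    refine ne_top_of_le_ne_top ?_ ((eVariationOn_tsum_le fun x _ => (hsingle x).summable).trans
      (ENNReal.tsum_le_tsum hpiece))
    rw [ENNReal.tsum_add, ENNReal.tsum_add, ENNReal.tsum_mul_right, ENNReal.tsum_mul_left,
      ENNReal.tsum_mul_left, ENNReal.tsum_mul_left, ENNReal.tsum_mul_right]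
    have hlen := F.tsum_length_ne_top
    have hVtop : V ≠ ∞ := ih
    finiteness

/-- The Lasota–Yorke inequality for an iterate of the transfer operator. -/
theorem exists_lasotaYorke [Countable ι] (hF : F.IsProper) : ∃ n : ℕ, 0 < n ∧
    ∃ C : ℝ≥0∞, C ≠ ∞ ∧ ∀ f : ℝ → ℂ,
      eVariationOn (F.transferFun^[n] f) (Icc F.a F.b) ≤
        2⁻¹ * eVariationOn f (Icc F.a F.b) + C * ∫⁻ x, ‖f x‖ₑ ∂F.m := by
  have h1 : F.bound ^ 2 < 1 := by
    have : F.bound < 1 := hF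
    have := F.bound_nonneg
    nlinarith
  -- multiplication by the weight contracts the variation by `5 * (bound ^ 2) ^ n ≤ 1 / 2`
  obtain ⟨n, hn⟩ := exists_pow_lt_of_lt_one (show (0 : ℝ) < 1 / 10 by norm_num) h1
  have hn0 : 0 < n := by
    rcases Nat.eq_zero_or_pos n with rfl | h
    · norm_num at hn
    · exact h
  have hpos := F.bound_pos
  obtain ⟨C, hC, hCf⟩ := exists_eVariationOn_smul_le (w := F.weight n) F.a_lt_b.le
    (F.boundedVariationOn_weight n) (show 0 < (F.bound ^ 2) ^ n by positivity)
    (F.weight_nonneg n) (F.weight_le n)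
  refine ⟨n, hn0, C, hC, fun f => (F.eVariationOn_transferFun_iterate_le n f).trans
    ((hCf f).trans ?_)⟩
  gcongr
  have : (2⁻¹ : ℝ≥0∞) = ENNReal.ofReal 2⁻¹ := by
    rw [ENNReal.ofReal_inv_of_pos (by norm_num)]; simp
  rw [this]
  exact ENNReal.ofReal_le_ofReal (by linarith)

theorem boundedVariationOn_transferFun [Countable ι] {f : ℝ → ℂ}
    (hf : BoundedVariationOn f (Icc F.a F.b)) :
    BoundedVariationOn (F.transferFun f) (Icc F.a F.b) := by
  have hpos := F.bound_pos
  have hw : BoundedVariationOn (fun x => F.weight 1 x • f x) (Icc F.a F.b) := by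
    have h1 : ∀ x ∈ Icc F.a F.b, ‖F.weight 1 x‖ₑ ≤ ENNReal.ofReal ((F.bound ^ 2) ^ 1) := by
      intro x _
      rw [Real.enorm_eq_ofReal (F.weight_nonneg 1 x)]
      exact ENNReal.ofReal_le_ofReal (F.weight_le 1 x)
    have h2 : ∀ x ∈ Icc F.a F.b, ‖f x‖ₑ ≤ ‖f F.a‖ₑ + eVariationOn f (Icc F.a F.b) := by
      exact fun x hx => enorm_le_add_eVariationOn f hx (left_mem_Icc.2 F.a_lt_b.le)
    refine ne_top_of_le_ne_top ?_ (eVariationOn_fun_smul_le h1 h2)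
    have h3 : eVariationOn f (Icc F.a F.b) ≠ ∞ := hf
    have h4 : eVariationOn (F.weight 1) (Icc F.a F.b) ≠ ∞ := F.boundedVariationOn_weight 1
    finiteness
  exact ne_top_of_le_ne_top hw (F.eVariationOn_transferFun_le f)

end LasotaYorke

/-! ### Null sets and the transfer operator on L¹ -/

section Integrable

variable {ι : Type*} (F : IwasawaCF ι)

theorem ae_m_iff {p : ℝ → Prop} :
    (∀ᵐ x ∂F.m, p x) ↔ volume {x | x ∈ Icc F.a F.b ∧ ¬ p x} = 0 := by
  rw [ae_restrict_iff' measurableSet_Icc, ae_iff]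
  simp only [Classical.not_imp]

theorem countable_compl_pieces : (Icc F.a F.b \ F.pieces).Countable := F.countable_compl

theorem differentiableOn_T (i : ι) : DifferentiableOn ℝ F.T (F.piece i) := by
  refine DifferentiableOn.congr (f := fun x => F.s i * (1 / x) + F.c i) ?_ (F.T_eq i)
  intro x hx
  have := F.ne_zero_of_mem hx
  exact DifferentiableAt.differentiableWithinAt (by fun_prop (disch := assumption))

theorem mapsTo_iterate (n : ℕ) : MapsTo (F.T^[n]) (Icc F.a F.b) (Icc F.a F.b) :=
  F.mapsTo.iterate n

theorem integral_term (f : ℝ → ℂ) (i : ι) :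
    ∫ y, F.term f i y ∂F.m = ∫ x in F.piece i, f x := by
  have h1 : F.term f i = (F.dom i).indicator fun y => |deriv (F.inv i) y| • f (F.inv i y) := by
    funext y
    by_cases hy : y ∈ F.dom i <;> simp [term, hy]
  rw [h1, integral_indicator (F.measurableSet_dom i), Measure.restrict_restrict
    (F.measurableSet_dom i), inter_eq_left.2 (F.dom_subset i), ← F.inv_image i,
    integral_image_eq_integral_abs_deriv_smul (F.measurableSet_dom i)
      (fun y hy => (F.differentiableAt_inv hy).hasDerivAt.hasDerivWithinAt) (F.inv_injOn i)]

theorem integrable_of_boundedVariationOn {f : ℝ → ℂ}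
    (hf : BoundedVariationOn f (Icc F.a F.b)) : Integrable f F.m := by
  refine ⟨hf.aestronglyMeasurable_complex measurableSet_Icc, ?_⟩
  have h1 : ∀ x ∈ Icc F.a F.b, ‖f x‖ₑ ≤ ‖f F.a‖ₑ + eVariationOn f (Icc F.a F.b) := by
    exact fun x hx => enorm_le_add_eVariationOn f hx (left_mem_Icc.2 F.a_lt_b.le)
  refine (setLIntegral_mono' measurableSet_Icc h1).trans_lt ?_
  rw [lintegral_const, Measure.restrict_apply_univ, Real.volume_Icc]
  have h2 : eVariationOn f (Icc F.a F.b) ≠ ∞ := hf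
  finiteness

variable [Countable ι]

/-- `T` maps null sets to null sets. -/
theorem volume_image_T {N : Set ℝ} (hN : volume N = 0) (hNI : N ⊆ Icc F.a F.b) :
    volume (F.T '' N) = 0 := by
  have h1 : F.T '' N ⊆ F.T '' (Icc F.a F.b \ F.pieces) ∪ ⋃ i, F.T '' (N ∩ F.piece i) := by
    rintro _ ⟨x, hx, rfl⟩
    by_cases hp : x ∈ F.pieces
    · obtain ⟨i, hi⟩ := mem_iUnion.1 hp
      exact Or.inr (mem_iUnion.2 ⟨i, mem_image_of_mem _ ⟨hx, hi⟩⟩)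
    · exact Or.inl (mem_image_of_mem _ ⟨hNI hx, hp⟩)
  refine measure_mono_null h1 (measure_union_null
    ((F.countable_compl_pieces.image _).measure_zero _) (measure_iUnion_null fun i => ?_))
  exact addHaar_image_eq_zero_of_differentiableOn_of_addHaar_eq_zero _
    ((F.differentiableOn_T i).mono inter_subset_right) (measure_mono_null inter_subset_left hN)

/-- The preimage of a null set under `T` is a null set. -/
theorem volume_preimage_T {N : Set ℝ} (hN : volume N = 0) :
    volume (Icc F.a F.b ∩ F.T ⁻¹' N) = 0 := by
  have h1 : Icc F.a F.b ∩ F.T ⁻¹' N ⊆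
      (Icc F.a F.b \ F.pieces) ∪ ⋃ i, F.inv i '' (N ∩ F.dom i) := by
    rintro x ⟨hx, hxN⟩
    by_cases hp : x ∈ F.pieces
    · obtain ⟨i, hi⟩ := mem_iUnion.1 hp
      exact Or.inr (mem_iUnion.2 ⟨i, F.T x, ⟨hxN, mem_image_of_mem _ hi⟩, F.inv_T hi⟩)
    · exact Or.inl ⟨hx, hp⟩
  refine measure_mono_null h1 (measure_union_null (F.countable_compl_pieces.measure_zero _)
    (measure_iUnion_null fun i => ?_))
  exact addHaar_image_eq_zero_of_differentiableOn_of_addHaar_eq_zero _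
    (fun y hy => (F.differentiableAt_inv hy.2).differentiableWithinAt)
    (measure_mono_null inter_subset_left hN)

theorem volume_image_iterate {N : Set ℝ} (hN : volume N = 0) (hNI : N ⊆ Icc F.a F.b) (n : ℕ) :
    volume (F.T^[n] '' N) = 0 := by
  induction n with
  | zero => simpa using hN
  | succ n ih =>
    rw [Function.iterate_succ', image_comp]
    exact F.volume_image_T ih ((F.mapsTo_iterate n).mono_left hNI).image_subset

theorem volume_preimage_iterate {N : Set ℝ} (hN : volume N = 0) (n : ℕ) :
    volume (Icc F.a F.b ∩ F.T^[n] ⁻¹' N) = 0 := by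
  induction n with
  | zero => exact measure_mono_null inter_subset_right hN
  | succ n ih =>
    refine measure_mono_null ?_ (F.volume_preimage_T ih)
    rintro x ⟨hx, hx'⟩
    exact ⟨hx, F.mapsTo hx, by simpa using hx'⟩

/-- The terms of the transfer operator only depend on the class of a function, also for
non-measurable functions. -/
theorem term_congr_ae {f g : ℝ → ℂ} (h : f =ᵐ[F.m] g) :
    ∀ᵐ y ∂F.m, ∀ i, F.term f i y = F.term g i y := by
  have h0 := F.ae_m_iff.1 h
  refine F.ae_m_iff.2 (measure_mono_null ?_ (F.volume_image_T h0 fun x hx => hx.1))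
  rintro y ⟨hy, hne⟩
  push Not at hne
  obtain ⟨i, hi⟩ := hne
  by_cases hd : y ∈ F.dom i
  · refine ⟨F.inv i y, ⟨F.piece_subset i (F.inv_mem hd), fun he => hi ?_⟩, F.T_inv hd⟩
    rw [F.term_of_mem _ hd, F.term_of_mem _ hd, he]
  · exact absurd (by rw [F.term_of_notMem _ hd, F.term_of_notMem _ hd]) hi

theorem transferFun_congr_ae {f g : ℝ → ℂ} (h : f =ᵐ[F.m] g) :
    F.transferFun f =ᵐ[F.m] F.transferFun g := by
  filter_upwards [F.term_congr_ae h] with y hy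
  exact tsum_congr hy

/-- The transfer operator on `L¹(I)` may be computed with any representative. -/
theorem coeFn_transfer {φ : F.L1} {f : ℝ → ℂ} (h : φ =ᵐ[F.m] f) :
    F.transfer φ =ᵐ[F.m] F.transferFun f :=
  (Integrable.coeFn_toL1 (F.integrable_transferFun (Lp.stronglyMeasurable φ)
    (L1.integrable_coeFn φ))).trans (F.transferFun_congr_ae h)

theorem coeFn_transfer_iterate {φ : F.L1} {f : ℝ → ℂ} (h : φ =ᵐ[F.m] f) (n : ℕ) :
    (F.transfer ^ n) φ =ᵐ[F.m] F.transferFun^[n] f := by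
  induction n with
  | zero => simpa using h
  | succ n ih =>
    rw [pow_succ', Module.End.mul_apply, Function.iterate_succ_apply']
    exact F.coeFn_transfer ih

theorem aestronglyMeasurable_term {f : ℝ → ℂ} (hf : AEStronglyMeasurable f F.m) (i : ι) :
    AEStronglyMeasurable (F.term f i) F.m := by
  refine ⟨F.term (hf.mk f) i, F.stronglyMeasurable_term hf.stronglyMeasurable_mk i, ?_⟩
  filter_upwards [F.term_congr_ae hf.ae_eq_mk] with y hy using hy i

theorem lintegral_tsum_term_le {f : ℝ → ℂ} (hf : AEStronglyMeasurable f F.m) :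
    ∫⁻ y, ∑' i, ‖F.term f i y‖ₑ ∂F.m ≤ ∫⁻ x, ‖f x‖ₑ ∂F.m := by
  rw [lintegral_tsum fun i => (F.aestronglyMeasurable_term hf i).enorm]
  exact F.tsum_lintegral_term_le f

theorem lintegral_enorm_transfer_le (φ : F.L1) :
    ∫⁻ x, ‖F.transfer φ x‖ₑ ∂F.m ≤ ∫⁻ x, ‖φ x‖ₑ ∂F.m := by
  refine le_trans (lintegral_mono_ae ?_)
    (F.lintegral_tsum_term_le (Lp.aestronglyMeasurable φ))
  filter_upwards [F.coeFn_transfer (ae_eq_refl φ)] with y hy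
  rw [hy]
  exact enorm_tsum_le_tsum_enorm

theorem lintegral_enorm_transfer_pow_le (n : ℕ) (φ : F.L1) :
    ∫⁻ x, ‖(F.transfer ^ n) φ x‖ₑ ∂F.m ≤ ∫⁻ x, ‖φ x‖ₑ ∂F.m := by
  induction n with
  | zero => simp
  | succ n ih =>
    rw [pow_succ', Module.End.mul_apply]
    exact (F.lintegral_enorm_transfer_le _).trans ih

theorem norm_transfer_pow_le (n : ℕ) (φ : F.L1) : ‖(F.transfer ^ n) φ‖ ≤ ‖φ‖ := by
  rw [L1.norm_def, L1.norm_def]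
  exact ENNReal.toReal_mono (L1.integrable_coeFn φ).2.ne (F.lintegral_enorm_transfer_pow_le n φ)

/-- The transfer operator preserves the integral. -/
theorem integral_transfer (φ : F.L1) : ∫ x, F.transfer φ x ∂F.m = ∫ x, φ x ∂F.m := by
  have hφ := L1.integrable_coeFn φ
  have hd : Pairwise (Function.onFun Disjoint F.piece) := F.pairwise_disjoint
  rw [integral_congr_ae (F.coeFn_transfer (ae_eq_refl φ))]
  have h1 : ∫ y, F.transferFun φ y ∂F.m = ∑' i, ∫ y, F.term φ i y ∂F.m :=
    integral_tsum (fun i => F.aestronglyMeasurable_term (Lp.aestronglyMeasurable φ) i)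
      ((F.tsum_lintegral_term_le φ).trans_lt hφ.2).ne
  have h2 : F.pieces =ᵐ[volume] Icc F.a F.b := by
    refine F.pieces_subset.eventuallyLE.antisymm ?_
    exact ae_le_set.2 (F.countable_compl_pieces.measure_zero _)
  rw [h1, ← setIntegral_congr_set h2, pieces,
    integral_iUnion (s := F.piece) (fun i => measurableSet_Ioo) hd
      (IntegrableOn.mono_set hφ F.pieces_subset)]
  exact tsum_congr fun i => F.integral_term _ i

theorem integral_transfer_pow (n : ℕ) (φ : F.L1) :
    ∫ x, (F.transfer ^ n) φ x ∂F.m = ∫ x, φ x ∂F.m := by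
  induction n with
  | zero => simp
  | succ n ih => rw [pow_succ', Module.End.mul_apply, F.integral_transfer, ih]

theorem transfer_mem_BV {φ : F.L1} (hφ : φ ∈ F.BV) : F.transfer φ ∈ F.BV := by
  obtain ⟨g, hg, h⟩ := hφ
  exact ⟨F.transferFun g, F.boundedVariationOn_transferFun hg, F.coeFn_transfer h⟩

end Integrable

/-! ### Existence of an invariant density -/

section Existence

variable {ι : Type*} (F : IwasawaCF ι)

/-- The class `φ` in `L¹(I)` has a representative of variation at most `V` on `I`. -/
def HasVariationLE (φ : F.L1) (V : ℝ≥0∞) : Prop :=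
  ∃ g : ℝ → ℂ, eVariationOn g (Icc F.a F.b) ≤ V ∧ φ =ᵐ[F.m] g

theorem HasVariationLE.add {F : IwasawaCF ι} {φ ψ : F.L1} {V W : ℝ≥0∞}
    (hφ : F.HasVariationLE φ V) (hψ : F.HasVariationLE ψ W) :
    F.HasVariationLE (φ + ψ) (V + W) := by
  obtain ⟨f, hf, hf'⟩ := hφ
  obtain ⟨g, hg, hg'⟩ := hψ
  exact ⟨f + g, (eVariationOn_add_le _ _ _).trans (add_le_add hf hg),
    (Lp.coeFn_add φ ψ).trans (hf'.add hg')⟩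

theorem HasVariationLE.smul {F : IwasawaCF ι} {φ : F.L1} {V : ℝ≥0∞} (c : ℂ)
    (hφ : F.HasVariationLE φ V) : F.HasVariationLE (c • φ) (‖c‖ₑ * V) := by
  obtain ⟨f, hf, hf'⟩ := hφ
  refine ⟨c • f, (eVariationOn_const_smul_le _ _ _).trans (by gcongr),
    (Lp.coeFn_smul c φ).trans ?_⟩
  filter_upwards [hf'] with x hx
  simp [hx]

theorem hasVariationLE_zero : F.HasVariationLE 0 0 :=
  ⟨0, (eVariationOn.constant_on (by rintro _ ⟨x, -, rfl⟩ _ ⟨y, -, rfl⟩; rfl)).le,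
    Lp.coeFn_zero _ _ _⟩

theorem exists_mem_BV_tendsto {A : ℕ → F.L1} {V : ℝ≥0∞} {B : ℝ} (hVtop : V ≠ ∞)
    (hV : ∀ n, F.HasVariationLE (A n) V) (hB : ∀ n, ‖A n‖ ≤ B) :
    ∃ φ ∈ F.BV, Tendsto A (hyperfilter ℕ) (𝓝 φ) := by
  choose u hu hAu using hV
  obtain ⟨w, hw, hlim⟩ := exists_tendsto_hyperfilter F.a_lt_b hVtop (B := ENNReal.ofReal B)
    ENNReal.ofReal_ne_top hu fun n => by
      have h : ∫⁻ x, ‖A n x‖ₑ ∂F.m = ∫⁻ x, ‖u n x‖ₑ ∂F.m :=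
        lintegral_congr_ae ((hAu n).fun_comp enorm)
      rw [← h]
      refine (ENNReal.le_ofReal_iff_toReal_le (L1.integrable_coeFn (A n)).2.ne
        ((norm_nonneg _).trans (hB n))).2 ?_
      rw [← L1.norm_def]
      exact hB n
  have hwbv : BoundedVariationOn w (Icc F.a F.b) := ne_top_of_le_ne_top hVtop hw
  have hint := F.integrable_of_boundedVariationOn hwbv
  refine ⟨hint.toL1 w, ⟨w, hwbv, hint.coeFn_toL1⟩, ?_⟩
  rw [tendsto_iff_norm_sub_tendsto_zero]
  have h1 : ∀ n, ‖A n - hint.toL1 w‖ = (∫⁻ x in Icc F.a F.b, ‖u n x - w x‖ₑ).toReal := by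
    intro n
    rw [L1.norm_def]
    congr 1
    refine lintegral_congr_ae ?_
    filter_upwards [Lp.coeFn_sub (A n) (hint.toL1 w), hAu n, hint.coeFn_toL1] with x h1 h2 h3
    rw [h1, Pi.sub_apply, h2, h3]
  simp_rw [h1]
  have := (ENNReal.tendsto_toReal ENNReal.zero_ne_top).comp hlim
  rwa [ENNReal.toReal_zero] at this

/-- The constant function `1` in `L¹(I)`. -/
def one : F.L1 := (integrable_const (1 : ℂ)).toL1 (fun _ => (1 : ℂ))

theorem coeFn_one : F.one =ᵐ[F.m] fun _ => (1 : ℂ) := Integrable.coeFn_toL1 _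

theorem integral_one : ∫ x, F.one x ∂F.m = ((F.b - F.a : ℝ) : ℂ) := by
  rw [integral_congr_ae F.coeFn_one]
  simp [m, F.a_lt_b.le]

variable [Countable ι]

/-- Some iterate of the transfer operator has powers along which the variation of the images of
the constant function stays bounded. -/
theorem exists_bounded_variation_iterates (hF : F.IsProper) : ∃ n : ℕ, 0 < n ∧
    ∃ V : ℝ≥0∞, V ≠ ∞ ∧ ∀ k, F.HasVariationLE (((F.transfer ^ n) ^ k) F.one) V := by
  obtain ⟨n, hn, C, hC, hLY⟩ := F.exists_lasotaYorke hF
  set L := ∫⁻ x, ‖F.one x‖ₑ ∂F.m with hL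
  have hLtop : L ≠ ∞ := (L1.integrable_coeFn F.one).2.ne
  -- `V = 2 C L` solves `V = V / 2 + C L`
  refine ⟨n, hn, 2 * (C * L), by finiteness, fun k => ?_⟩
  induction k with
  | zero =>
    refine ⟨fun _ => 1, ?_, F.coeFn_one⟩
    rw [eVariationOn.constant_on (by rintro _ ⟨x, -, rfl⟩ _ ⟨y, -, rfl⟩; rfl)]
    exact zero_le
  | succ k ih =>
    obtain ⟨g, hg, hg'⟩ := ih
    refine ⟨F.transferFun^[n] g, (hLY g).trans ?_, ?_⟩
    · have h1 : ∫⁻ x, ‖g x‖ₑ ∂F.m ≤ L := by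
        have h : ∫⁻ x, ‖((F.transfer ^ n) ^ k) F.one x‖ₑ ∂F.m = ∫⁻ x, ‖g x‖ₑ ∂F.m :=
          lintegral_congr_ae (hg'.fun_comp enorm)
        rw [← h, ← pow_mul]
        exact F.lintegral_enorm_transfer_pow_le _ _
      calc 2⁻¹ * eVariationOn g (Icc F.a F.b) + C * ∫⁻ x, ‖g x‖ₑ ∂F.m
          ≤ 2⁻¹ * (2 * (C * L)) + C * L := by gcongr
        _ = 2 * (C * L) := by
          rw [← mul_assoc, ENNReal.inv_mul_cancel (by simp) (by simp), one_mul, two_mul]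
    · rw [pow_succ', Module.End.mul_apply]
      exact F.coeFn_transfer_iterate hg' n

/-- There is an invariant density of bounded variation. -/
theorem exists_fixed_point (hF : F.IsProper) : ∃ φ ∈ F.BV, F.transfer φ = φ ∧ φ ≠ 0 := by
  obtain ⟨n, hn, V, hVtop, hV⟩ := F.exists_bounded_variation_iterates hF
  set K := F.transfer ^ n with hK
  have hKnorm : ∀ φ, ‖K φ‖ ≤ ‖φ‖ := F.norm_transfer_pow_le n
  have hKpow : ∀ k φ, ‖(K ^ k) φ‖ ≤ ‖φ‖ := fun k φ => by
    rw [hK, ← pow_mul]; exact F.norm_transfer_pow_le _ _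
  have hKint : ∀ k φ, ∫ x, (K ^ k) φ x ∂F.m = ∫ x, φ x ∂F.m := fun k φ => by
    rw [hK, ← pow_mul]; exact F.integral_transfer_pow _ _
  let S : ℕ → F.L1 := fun m => ∑ k ∈ Finset.range m, (K ^ k) F.one
  have hSsucc : ∀ m, S (m + 1) = S m + (K ^ m) F.one := fun m => Finset.sum_range_succ _ _
  have hSvar : ∀ m : ℕ, F.HasVariationLE (S m) (m * V) := by
    intro m
    induction m with
    | zero => simpa [S] using F.hasVariationLE_zero
    | succ m ih =>
      rw [hSsucc, Nat.cast_succ, add_mul, one_mul]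
      exact ih.add (hV m)
  have hSnorm : ∀ m : ℕ, ‖S m‖ ≤ m * ‖F.one‖ := by
    intro m
    refine (norm_sum_le _ _).trans ((Finset.sum_le_sum fun k _ => hKpow k F.one).trans ?_)
    simp
  have hSint : ∀ m : ℕ, ∫ x, S m x ∂F.m = m * ((F.b - F.a : ℝ) : ℂ) := by
    intro m
    induction m with
    | zero =>
      rw [show S 0 = 0 from rfl, integral_congr_ae (Lp.coeFn_zero _ _ _)]
      simp
    | succ m ih =>
      rw [hSsucc, integral_congr_ae (Lp.coeFn_add _ _)]
      simp only [Pi.add_apply]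
      rw [integral_add (L1.integrable_coeFn _) (L1.integrable_coeFn _), ih, hKint,
        F.integral_one]
      push_cast
      ring
  -- the sums telescope
  have hKS : ∀ m, K (S m) - S m = (K ^ m) F.one - F.one := by
    intro m
    induction m with
    | zero => simp [S]
    | succ m ih =>
      rw [hSsucc, map_add, pow_succ' K m, Module.End.mul_apply]
      rw [add_sub_add_comm, ih]
      abel
  let A : ℕ → F.L1 := fun m => ((m + 1 : ℕ) : ℂ)⁻¹ • S (m + 1)
  have hc : ∀ m : ℕ, ((m + 1 : ℕ) : ℂ) ≠ 0 := fun m => Nat.cast_ne_zero.2 m.succ_ne_zero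
  have hAvar : ∀ m, F.HasVariationLE (A m) V := by
    intro m
    have h := (hSvar (m + 1)).smul ((m + 1 : ℕ) : ℂ)⁻¹
    have h2 : ‖((m + 1 : ℕ) : ℂ)⁻¹‖ₑ * (((m + 1 : ℕ) : ℝ≥0∞) * V) = V := by
      have h3 : ‖((m + 1 : ℕ) : ℂ)⁻¹‖ₑ * ((m + 1 : ℕ) : ℝ≥0∞) = 1 := by
        have h4 : ((m + 1 : ℕ) : ℝ≥0∞) = ‖((m + 1 : ℕ) : ℂ)‖ₑ := by
          rw [← ofReal_norm, Complex.norm_natCast, ENNReal.ofReal_natCast]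
        rw [h4, ← enorm_mul, inv_mul_cancel₀ (hc m), enorm_one]
      rw [← mul_assoc, h3, one_mul]
    rwa [h2] at h
  have hAnorm : ∀ m, ‖A m‖ ≤ ‖F.one‖ := by
    intro m
    have hm : (0 : ℝ) < (m + 1 : ℕ) := by positivity
    calc ‖A m‖ = ((m + 1 : ℕ) : ℝ)⁻¹ * ‖S (m + 1)‖ := by
          simp only [A]; rw [norm_smul, norm_inv, Complex.norm_natCast]
      _ ≤ ((m + 1 : ℕ) : ℝ)⁻¹ * ((m + 1 : ℕ) * ‖F.one‖) := by gcongr; exact hSnorm _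
      _ = ‖F.one‖ := by field_simp
  have hAint : ∀ m, ∫ x, A m x ∂F.m = ((F.b - F.a : ℝ) : ℂ) := by
    intro m
    simp only [A]
    rw [integral_congr_ae (Lp.coeFn_smul _ _)]
    simp only [Pi.smul_apply]
    rw [integral_smul, hSint, smul_eq_mul, ← mul_assoc, inv_mul_cancel₀ (hc m), one_mul]
  have hKA : Tendsto (fun m => K (A m) - A m) (hyperfilter ℕ) (𝓝 0) := by
    have h1 : Tendsto (fun m : ℕ => (2 * ‖F.one‖) / ((m : ℝ) + 1)) atTop (𝓝 0) := by
      have := (tendsto_one_div_add_atTop_nhds_zero_nat (𝕜 := ℝ)).const_mul (2 * ‖F.one‖)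
      simpa [div_eq_mul_inv] using this
    refine squeeze_zero_norm (fun m => ?_) (h1.mono_left Nat.hyperfilter_le_atTop)
    have h2 : K (A m) - A m = ((m + 1 : ℕ) : ℂ)⁻¹ • ((K ^ (m + 1)) F.one - F.one) := by
      simp only [A]
      rw [map_smul, ← smul_sub, hKS]
    rw [h2, norm_smul, norm_inv, Complex.norm_natCast, div_eq_inv_mul]
    push_cast
    gcongr
    refine (norm_sub_le _ _).trans ?_
    linarith [hKpow (m + 1) F.one]
  obtain ⟨φ, hφ, hlim⟩ := F.exists_mem_BV_tendsto hVtop hAvar hAnorm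
  have hKφ : K φ = φ := by
    have hcont : Continuous K :=
      (LinearMap.mkContinuous K 1 fun ψ => by rw [one_mul]; exact hKnorm ψ).continuous
    have h1 := ((hcont.tendsto φ).comp hlim).sub hlim
    exact sub_eq_zero.1 (tendsto_nhds_unique h1 hKA)
  have hφint : ∫ x, φ x ∂F.m = ((F.b - F.a : ℝ) : ℂ) := by
    have h1 := (continuous_integral.tendsto φ).comp hlim
    refine tendsto_nhds_unique h1 ?_
    simp only [Function.comp_def, hAint]
    exact tendsto_const_nhds
  have hBVpow : ∀ j, (F.transfer ^ j) φ ∈ F.BV := by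
    intro j
    induction j with
    | zero => simpa using hφ
    | succ j ih =>
      rw [pow_succ', Module.End.mul_apply]
      exact F.transfer_mem_BV ih
  refine ⟨∑ j ∈ Finset.range n, (F.transfer ^ j) φ, F.BV.sum_mem fun j _ => hBVpow j, ?_, ?_⟩
  · rw [map_sum]
    have h1 := Finset.sum_range_succ (fun j => (F.transfer ^ j) φ) n
    have h2 := Finset.sum_range_succ' (fun j => (F.transfer ^ j) φ) n
    rw [h1] at h2
    simp only [pow_zero, Module.End.one_apply, pow_succ', Module.End.mul_apply] at h2
    rw [show (F.transfer ^ n) φ = φ from hKφ] at h2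
    exact (add_right_cancel h2).symm
  · intro h0
    have h1 : ∀ m : ℕ, ∫ x, (∑ j ∈ Finset.range m, (F.transfer ^ j) φ : F.L1) x ∂F.m =
        m * ((F.b - F.a : ℝ) : ℂ) := by
      intro m
      induction m with
      | zero =>
        rw [Finset.sum_range_zero, integral_congr_ae (Lp.coeFn_zero _ _ _)]
        simp
      | succ m ih =>
        rw [Finset.sum_range_succ, integral_congr_ae (Lp.coeFn_add _ _)]
        simp only [Pi.add_apply]
        rw [integral_add (L1.integrable_coeFn _) (L1.integrable_coeFn _), ih,
          F.integral_transfer_pow, hφint]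
        push_cast
        ring
    have h2 := h1 n
    rw [h0, integral_congr_ae (Lp.coeFn_zero _ _ _)] at h2
    simp only [Pi.zero_apply, integral_zero] at h2
    have h3 : ((F.b - F.a : ℝ) : ℂ) ≠ 0 := by
      exact_mod_cast (sub_pos.2 F.a_lt_b).ne'
    exact mul_ne_zero (Nat.cast_ne_zero.2 hn.ne') h3 h2.symm

end Existence

/-! ### Phases of eigenfunctions -/

section Phases

variable {ι : Type*} (F : IwasawaCF ι) [Countable ι]

/-- For an eigenfunction with eigenvalue of modulus one, the modulus is an invariant density, so
that there is no cancellation in the transfer operator: the phase changes by a constant factor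
along orbits. -/
theorem ae_phase_T {g : ℝ → ℂ} {z : ℂ} (hg : Integrable g F.m) (hz : ‖z‖ = 1)
    (hgz : F.transferFun g =ᵐ[F.m] fun y => z * g y) :
    ∀ᵐ x ∂F.m, g x ≠ 0 →
      g (F.T x) ≠ 0 ∧ g x * ‖g (F.T x)‖ = ‖g x‖ * (z * g (F.T x)) := by
  -- `|g| = |H g| ≤ ∑ |terms|`, and the integrals show that this is an equality
  have hle : (fun y => ‖g y‖ₑ) ≤ᵐ[F.m] fun y => ∑' i, ‖F.term g i y‖ₑ := by
    filter_upwards [hgz] with y hy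
    have hz' : ‖z‖ₑ = 1 := by rw [← ofReal_norm, hz, ENNReal.ofReal_one]
    calc ‖g y‖ₑ = ‖F.transferFun g y‖ₑ := by rw [hy, enorm_mul, hz', one_mul]
      _ ≤ _ := enorm_tsum_le_tsum_enorm
  have heq : (fun y => ‖g y‖ₑ) =ᵐ[F.m] fun y => ∑' i, ‖F.term g i y‖ₑ :=
    ae_eq_of_ae_le_of_lintegral_le hle hg.2.ne
      (AEMeasurable.tsum fun i => (F.aestronglyMeasurable_term hg.1 i).enorm)
      (F.lintegral_tsum_term_le hg.1)
  have hY := F.ae_m_iff.1 (heq.and hgz)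
  refine F.ae_m_iff.2 (measure_mono_null ?_ (measure_union_null
    (F.countable_compl_pieces.measure_zero _) (F.volume_preimage_T hY)))
  rintro x ⟨hx, hne⟩
  by_cases hp : x ∈ F.pieces
  swap
  · exact Or.inl ⟨hx, hp⟩
  refine Or.inr ⟨hx, F.mapsTo hx, fun hgood => hne fun hgx => ?_⟩
  obtain ⟨h1, h2⟩ := hgood
  change ‖g (F.T x)‖ₑ = ∑' i, ‖F.term g i (F.T x)‖ₑ at h1
  obtain ⟨i, hi⟩ := mem_iUnion.1 hp
  have hT : F.T x ∈ F.dom i := mem_image_of_mem _ hi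
  have hterm : F.term g i (F.T x) = ((x ^ 2 : ℝ) : ℂ) * g x := by
    rw [F.term_of_mem g hT, F.inv_T hi, Complex.real_smul]
  have hx2 : ((x ^ 2 : ℝ) : ℂ) ≠ 0 := by
    exact_mod_cast pow_ne_zero 2 (F.ne_zero_of_mem hi)
  have hgT : g (F.T x) ≠ 0 := by
    intro h0
    rw [h0, enorm_zero] at h1
    have h3 := (ENNReal.tsum_eq_zero.1 h1.symm) i
    rw [hterm, enorm_eq_zero] at h3
    exact mul_ne_zero hx2 hgx h3
  refine ⟨hgT, ?_⟩
  have h3 : ∑' j, F.term g j (F.T x) = z * g (F.T x) := h2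
  have h4 : ∑' j, ‖F.term g j (F.T x)‖ₑ = ‖∑' j, F.term g j (F.T x)‖ₑ := by
    rw [h3, ← h1, enorm_mul, ← ofReal_norm z, hz, ENNReal.ofReal_one, one_mul]
  have h5 := Complex.mul_norm_tsum_of_tsum_enorm_eq h4 i
  rw [h3, hterm, norm_mul, norm_mul, hz, one_mul, Complex.norm_real,
    Real.norm_of_nonneg (sq_nonneg x)] at h5
  apply mul_left_cancel₀ hx2
  push_cast at h5 ⊢
  linear_combination h5

/-- The phases along whole orbits. -/
theorem ae_phase_iterate {g : ℝ → ℂ} {z : ℂ} (hg : Integrable g F.m) (hz : ‖z‖ = 1)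
    (hgz : F.transferFun g =ᵐ[F.m] fun y => z * g y) :
    ∀ᵐ x ∂F.m, g x ≠ 0 → ∀ n : ℕ,
      g (F.T^[n] x) ≠ 0 ∧ g x * ‖g (F.T^[n] x)‖ = ‖g x‖ * (z ^ n * g (F.T^[n] x)) := by
  have h := F.ae_m_iff.1 (F.ae_phase_T hg hz hgz)
  have h' := measure_iUnion_null fun n => F.volume_preimage_iterate h n
  refine F.ae_m_iff.2 (measure_mono_null ?_ h')
  rintro x ⟨hx, hne⟩
  by_contra hx'
  refine hne fun hgx n => ?_
  have hgood : ∀ n, g (F.T^[n] x) ≠ 0 → g (F.T (F.T^[n] x)) ≠ 0 ∧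
      g (F.T^[n] x) * ‖g (F.T (F.T^[n] x))‖ =
        ‖g (F.T^[n] x)‖ * (z * g (F.T (F.T^[n] x))) := by
    intro n
    by_contra hn
    exact hx' (mem_iUnion.2 ⟨n, hx, F.mapsTo_iterate n hx, hn⟩)
  induction n with
  | zero => exact ⟨hgx, by simp [mul_comm]⟩
  | succ n ih =>
    obtain ⟨h1, h2⟩ := ih
    obtain ⟨h3, h4⟩ := hgood n h1
    rw [Function.iterate_succ_apply']
    refine ⟨h3, ?_⟩
    have h5 : (‖g (F.T^[n] x)‖ : ℂ) ≠ 0 := by simpa using h1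
    apply mul_left_cancel₀ h5
    linear_combination (‖g (F.T (F.T^[n] x))‖ : ℂ) * h2 + ‖g x‖ * z ^ n * h4

/-- By condition `(*)`, the phase of an eigenfunction cannot take separate values on two
intervals. -/
theorem exists_phase_eq (hstar : F.ConditionStar) {g : ℝ → ℂ} {z : ℂ} (hg : Integrable g F.m)
    (hz : ‖z‖ = 1) (hgz : F.transferFun g =ᵐ[F.m] fun y => z * g y) {p q p' q' : ℝ}
    (hap : F.a ≤ p) (hpq : p < q) (hqb : q ≤ F.b) (hap' : F.a ≤ p') (hpq' : p' < q')
    (hqb' : q' ≤ F.b) (h0 : ∀ x ∈ Icc p q, g x ≠ 0) (h0' : ∀ x ∈ Icc p' q', g x ≠ 0) :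
    ∃ x ∈ Icc p q, ∃ x' ∈ Icc p' q', g x * ‖g x'‖ = g x' * ‖g x‖ := by
  have hN := F.ae_m_iff.1 (F.ae_phase_iterate hg hz hgz)
  set N := {x | x ∈ Icc F.a F.b ∧ ¬ (g x ≠ 0 → ∀ n : ℕ,
      g (F.T^[n] x) ≠ 0 ∧ g x * ‖g (F.T^[n] x)‖ = ‖g x‖ * (z ^ n * g (F.T^[n] x)))} with hNdef
  obtain ⟨n, hn⟩ := hstar p q p' q' hap hpq hqb hap' hpq' hqb'
  have hTN := F.volume_image_iterate hN (fun x hx => hx.1) n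
  -- a point of the overlap that is not an image of an exceptional point
  obtain ⟨y, ⟨⟨x, hx, hxy⟩, ⟨x', hx', hxy'⟩⟩, hyN⟩ :
      ((F.T^[n] '' Icc p q ∩ F.T^[n] '' Icc p' q') \ (F.T^[n] '' N)).Nonempty := by
    refine nonempty_of_measure_ne_zero (μ := volume) ?_
    rw [measure_sdiff_null hTN]
    exact hn.ne'
  have hgood : ∀ u ∈ Icc F.a F.b, F.T^[n] u = y → g u ≠ 0 →
      g y ≠ 0 ∧ g u * ‖g y‖ = ‖g u‖ * (z ^ n * g y) := by
    intro u hu huy hgu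
    by_contra hcon
    refine hyN ⟨u, ⟨hu, fun h => hcon ?_⟩, huy⟩
    have := h hgu n
    rwa [huy] at this
  obtain ⟨h1, h2⟩ := hgood x ⟨hap.trans hx.1, hx.2.trans hqb⟩ hxy (h0 x hx)
  obtain ⟨-, h3⟩ := hgood x' ⟨hap'.trans hx'.1, hx'.2.trans hqb'⟩ hxy' (h0' x' hx')
  refine ⟨x, hx, x', hx', ?_⟩
  have h5 : (‖g y‖ : ℂ) ≠ 0 := by simpa using h1
  apply mul_left_cancel₀ h5
  linear_combination (‖g x'‖ : ℂ) * h2 - (‖g x‖ : ℂ) * h3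

/-- The phase of an eigenfunction agrees at any two continuity points. -/
theorem phase_eq_of_continuousAt (hstar : F.ConditionStar) {g : ℝ → ℂ} {z : ℂ}
    (hg : Integrable g F.m) (hz : ‖z‖ = 1) (hgz : F.transferFun g =ᵐ[F.m] fun y => z * g y)
    {x x' : ℝ} (hx : x ∈ Icc F.a F.b) (hx' : x' ∈ Icc F.a F.b) (hc : ContinuousAt g x)
    (hc' : ContinuousAt g x') (h0 : g x ≠ 0) (h0' : g x' ≠ 0) :
    g x * ‖g x'‖ = g x' * ‖g x‖ := by
  by_contra hne
  have hf : ContinuousAt (fun u : ℝ × ℝ => g u.1) (x, x') :=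
    ContinuousAt.comp (f := Prod.fst) (g := g) hc continuousAt_fst
  have hs : ContinuousAt (fun u : ℝ × ℝ => g u.2) (x, x') :=
    ContinuousAt.comp (f := Prod.snd) (g := g) hc' continuousAt_snd
  have h1 : ∀ᶠ u : ℝ × ℝ in 𝓝 (x, x'), g u.1 * ‖g u.2‖ - g u.2 * ‖g u.1‖ ≠ 0 :=
    ContinuousAt.eventually_ne
      ((hf.mul (Complex.continuous_ofReal.continuousAt.comp hs.norm)).sub
        (hs.mul (Complex.continuous_ofReal.continuousAt.comp hf.norm)))
      (sub_ne_zero.2 hne)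
  have h2 := (h1.and ((hf.eventually_ne h0).and (hs.eventually_ne h0')))
  obtain ⟨ε, hε, hball⟩ := Metric.eventually_nhds_iff.1 h2
  have hdist : ∀ {u v : ℝ}, |u - x| ≤ ε / 2 → |v - x'| ≤ ε / 2 →
      dist (u, v) (x, x') < ε := by
    intro u v hu hv
    rw [Prod.dist_eq, Real.dist_eq, Real.dist_eq]
    exact max_lt (by linarith) (by linarith)
  have hab := F.a_lt_b
  have hnear : ∀ w u : ℝ, u ∈ Icc (max F.a (w - ε / 2)) (min F.b (w + ε / 2)) →
      |u - w| ≤ ε / 2 := by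
    intro w u hu
    have h3 := (le_max_right _ _).trans hu.1
    have h4 := hu.2.trans (min_le_right _ _)
    rw [abs_le]; constructor <;> linarith
  have hlt : ∀ w ∈ Icc F.a F.b, max F.a (w - ε / 2) < min F.b (w + ε / 2) := by
    intro w hw
    refine max_lt (lt_min hab ?_) (lt_min ?_ ?_) <;> linarith [hw.1, hw.2]
  obtain ⟨u, hu, v, hv, huv⟩ := F.exists_phase_eq hstar hg hz hgz
    (p := max F.a (x - ε / 2)) (q := min F.b (x + ε / 2))
    (p' := max F.a (x' - ε / 2)) (q' := min F.b (x' + ε / 2))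
    (le_max_left _ _) (hlt x hx) (min_le_left _ _) (le_max_left _ _) (hlt x' hx')
    (min_le_left _ _)
    (fun u hu => (hball (y := (u, x')) (hdist (hnear _ _ hu) (by rw [sub_self, abs_zero]; positivity))).2.1)
    (fun v hv => (hball (y := (x, v)) (hdist (by rw [sub_self, abs_zero]; positivity) (hnear _ _ hv))).2.2)
  exact (hball (y := (u, v)) (hdist (hnear _ _ hu) (hnear _ _ hv))).1 (sub_eq_zero.2 huv)

/-- An eigenfunction of bounded variation with eigenvalue of modulus one is a constant times its
modulus, and the eigenvalue is one. -/
theorem eigenfunction_eq_const_mul_norm (hstar : F.ConditionStar) {φ : F.L1} (hφ : φ ∈ F.BV)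
    {z : ℂ} (hz : ‖z‖ = 1) (hφz : F.transfer φ = z • φ) (hφ0 : φ ≠ 0) :
    z = 1 ∧ ∃ c : ℂ, c ≠ 0 ∧ ∀ᵐ x ∂F.m, φ x = c * ‖φ x‖ := by
  obtain ⟨g, hgbv, hφg⟩ := hφ
  have hg := F.integrable_of_boundedVariationOn hgbv
  have hgz : F.transferFun g =ᵐ[F.m] fun y => z * g y := by
    have h1 := F.coeFn_transfer hφg
    rw [hφz] at h1
    filter_upwards [h1, Lp.coeFn_smul z φ, hφg] with y h1 h2 h3
    rw [← h1, h2, Pi.smul_apply, h3, smul_eq_mul]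
  have hcont : ∀ᵐ x ∂F.m, x ∈ Icc F.a F.b ∧ ContinuousAt g x := by
    rw [← uIcc_of_le F.a_lt_b.le] at hgbv
    have h1 := hgbv.ae_differentiableAt_of_mem_uIcc
    rw [uIcc_of_le F.a_lt_b.le] at h1
    rw [ae_restrict_iff' measurableSet_Icc]
    filter_upwards [h1] with x hx hxI using ⟨hxI, (hx hxI).continuousAt⟩
  have hne : ∃ᵐ x ∂F.m, g x ≠ 0 := by
    intro h0
    refine hφ0 ((Lp.eq_zero_iff_ae_eq_zero).2 ?_)
    filter_upwards [h0, hφg] with x h1 h2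
    rw [h2]
    simpa using h1
  obtain ⟨x₁, hx₁, hI₁, hc₁⟩ := (hne.and_eventually hcont).exists
  have hn₁ : (‖g x₁‖ : ℂ) ≠ 0 := by simpa using hx₁
  set c := g x₁ / ‖g x₁‖ with hc
  have hc0 : c ≠ 0 := div_ne_zero hx₁ hn₁
  have hphase : ∀ᵐ x ∂F.m, g x = c * ‖g x‖ := by
    filter_upwards [hcont] with x hx
    by_cases h0 : g x = 0
    · simp [h0]
    · have h1 := F.phase_eq_of_continuousAt hstar hg hz hgz hx.1 hI₁ hx.2 hc₁ h0 hx₁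
      rw [hc, div_mul_eq_mul_div, eq_div_iff hn₁, h1]
  have hphaseT : ∀ᵐ x ∂F.m, g (F.T x) = c * ‖g (F.T x)‖ := by
    refine F.ae_m_iff.2 (measure_mono_null ?_ (F.volume_preimage_T (F.ae_m_iff.1 hphase)))
    exact fun x hx => ⟨hx.1, F.mapsTo hx.1, hx.2⟩
  refine ⟨?_, c, hc0, ?_⟩
  -- both `x` and `T x` have phase `c`, and these phases differ by the factor `z`
  · obtain ⟨x, hx, ⟨h1, h2⟩, h3⟩ := (hne.and_eventually
      ((hphase.and hphaseT).and (F.ae_phase_T hg hz hgz))).exists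
    obtain ⟨h4, h5⟩ := h3 hx
    have h6 : (‖g x‖ : ℂ) ≠ 0 := by simpa using hx
    have h7 : (‖g (F.T x)‖ : ℂ) ≠ 0 := by simpa using h4
    have h8 : c * ‖g x‖ * ‖g (F.T x)‖ = ‖g x‖ * (z * (c * ‖g (F.T x)‖)) := by
      rw [← h1, ← h2]; exact h5
    apply mul_left_cancel₀ (mul_ne_zero (mul_ne_zero hc0 h6) h7)
    linear_combination -h8
  · filter_upwards [hphase, hφg] with x h1 h2
    rw [h2]; exact h1

/-- An invariant function of bounded variation with integral zero vanishes. -/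
theorem eq_zero_of_integral_eq_zero (hstar : F.ConditionStar) {φ : F.L1} (hφ : φ ∈ F.BV)
    (hφ1 : F.transfer φ = φ) (hint : ∫ x, φ x ∂F.m = 0) : φ = 0 := by
  by_contra h0
  obtain ⟨-, c, hc, h⟩ := F.eigenfunction_eq_const_mul_norm hstar hφ (z := 1) (by simp)
    (by simpa using hφ1) h0
  rw [integral_congr_ae h, integral_const_mul, integral_complex_ofReal] at hint
  rcases mul_eq_zero.1 hint with h1 | h1
  · exact hc h1
  · rw [Complex.ofReal_eq_zero, ← L1.norm_eq_integral_norm, norm_eq_zero] at h1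
    exact h0 h1

/-- There are no Jordan blocks for the eigenvalue `1`: with `ψ = H φ - φ` fixed by `H` one has
`Hⁿ φ = φ + n ψ`, which is bounded only if `ψ = 0`. -/
theorem transfer_eq_self_of_sub_sub {φ : F.L1}
    (h : F.transfer (F.transfer φ - φ) = F.transfer φ - φ) : F.transfer φ = φ := by
  set ψ := F.transfer φ - φ with hψ
  have h1 : F.transfer φ = φ + ψ := by rw [hψ]; abel
  have h2 : ∀ n : ℕ, (F.transfer ^ n) φ = φ + (n : ℂ) • ψ := by
    intro n
    induction n with
    | zero => simp
    | succ n ih =>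
      rw [pow_succ', Module.End.mul_apply, ih, map_add, map_smul, h, h1]
      push_cast
      rw [add_smul, one_smul]
      abel
  have h3 : ∀ n : ℕ, n * ‖ψ‖ ≤ 2 * ‖φ‖ := by
    intro n
    have h4 := F.norm_transfer_pow_le n φ
    have h5 : (n : ℂ) • ψ = (F.transfer ^ n) φ - φ := by rw [h2]; abel
    have h6 : ‖(n : ℂ) • ψ‖ = n * ‖ψ‖ := by rw [norm_smul, Complex.norm_natCast]
    rw [← h6, h5]
    exact (norm_sub_le _ _).trans (by linarith)
  have h4 : ψ = 0 := by
    by_contra h0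
    have hpos : 0 < ‖ψ‖ := norm_pos_iff.2 h0
    obtain ⟨n, hn⟩ := exists_nat_gt (2 * ‖φ‖ / ‖ψ‖)
    rw [div_lt_iff₀ hpos] at hn
    exact absurd (h3 n) (not_le.2 hn)
  rw [h1, h4, add_zero]

end Phases

end IwasawaCF

end

/-! ### The spectrum on the unit circle -/

theorem theorem2 {ι : Type*} [Countable ι] (F : IwasawaCF ι) (hproper : F.IsProper)
    (hstar : F.ConditionStar) :
    ∃ hBV : ∀ f ∈ F.BV, F.transfer f ∈ F.BV,
      Module.End.HasEigenvalue (F.transfer.restrict hBV) 1 ∧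
      Module.finrank ℂ (Module.End.eigenspace (F.transfer.restrict hBV) 1) = 1 ∧
      Module.finrank ℂ (Module.End.maxGenEigenspace (F.transfer.restrict hBV) 1) = 1 ∧
      ∀ z : ℂ, ‖z‖ = 1 → Module.End.HasEigenvalue (F.transfer.restrict hBV) z → z = 1 := by
  have hBV : ∀ f ∈ F.BV, F.transfer f ∈ F.BV := fun f hf => F.transfer_mem_BV hf
  refine ⟨hBV, ?_⟩
  set R : Module.End ℂ F.BV := F.transfer.restrict hBV
  have hRcoe : ∀ v : F.BV, (R v : F.L1) = F.transfer v := fun v => rfl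
  have hmem : ∀ v : F.BV, v ∈ R.eigenspace 1 ↔ F.transfer v = v := by
    intro v
    rw [Module.End.mem_eigenspace_iff, one_smul, Subtype.ext_iff, hRcoe]
  obtain ⟨φ, hφ, hφ1, hφ0⟩ := F.exists_fixed_point hproper
  have hφE : (⟨φ, hφ⟩ : F.BV) ∈ R.eigenspace 1 := (hmem _).2 hφ1
  have hφint : ∫ x, φ x ∂F.m ≠ 0 := fun h =>
    hφ0 (F.eq_zero_of_integral_eq_zero hstar hφ hφ1 h)
  have hdim : Module.finrank ℂ (R.eigenspace 1) = 1 := by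
    refine finrank_eq_one_iff'.2 ⟨⟨⟨φ, hφ⟩, hφE⟩, fun h => hφ0 ?_, fun w => ?_⟩
    · exact congrArg (fun v : R.eigenspace 1 => ((v : F.BV) : F.L1)) h
    · obtain ⟨⟨ψ, hψ⟩, hψE⟩ := w
      have hψ1 : F.transfer ψ = ψ := (hmem _).1 hψE
      set t := (∫ x, ψ x ∂F.m) / ∫ x, φ x ∂F.m with ht
      -- the multiple of `φ` with the integral of `ψ`
      have h0 : ψ - t • φ = 0 := by
        refine F.eq_zero_of_integral_eq_zero hstar (F.BV.sub_mem hψ (F.BV.smul_mem t hφ))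
          (by rw [map_sub, map_smul, hψ1, hφ1]) ?_
        have h1 : (ψ - t • φ : F.L1) =ᵐ[F.m] fun x => ψ x - t * φ x := by
          filter_upwards [Lp.coeFn_sub ψ (t • φ), Lp.coeFn_smul t φ] with x h1 h2
          rw [h1, Pi.sub_apply, h2, Pi.smul_apply, smul_eq_mul]
        rw [integral_congr_ae h1, integral_sub (L1.integrable_coeFn ψ)
          ((L1.integrable_coeFn φ).const_mul t), integral_const_mul, ht, div_mul_cancel₀ _ hφint,
          sub_self]
      exact ⟨t, Subtype.ext (Subtype.ext (sub_eq_zero.1 h0).symm)⟩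
  have hgen : R.maxGenEigenspace 1 = R.eigenspace 1 := by
    refine le_antisymm (fun v hv => ?_) Module.End.eigenspace_le_maxGenEigenspace
    obtain ⟨k, hk⟩ := (Module.End.mem_maxGenEigenspace _ _ _).1 hv
    have hstep : ∀ u : F.BV, (R - (1 : ℂ) • (1 : Module.End ℂ F.BV)) u ∈ R.eigenspace 1 →
        u ∈ R.eigenspace 1 := by
      intro u hu
      rw [hmem] at hu ⊢
      refine F.transfer_eq_self_of_sub_sub ?_
      simpa [hRcoe] using hu
    have hall : ∀ (k : ℕ) (u : F.BV),
        ((R - (1 : ℂ) • (1 : Module.End ℂ F.BV)) ^ k) u = 0 → u ∈ R.eigenspace 1 := by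
      intro k
      induction k with
      | zero =>
        intro u hu
        have : u = 0 := by simpa using hu
        rw [this]
        exact zero_mem _
      | succ k ih =>
        intro u hu
        rw [pow_succ, Module.End.mul_apply] at hu
        exact hstep u (ih _ hu)
    exact hall k v hk
  refine ⟨?_, hdim, hgen ▸ hdim, fun z hz hev => ?_⟩
  · exact Module.End.hasEigenvalue_of_hasEigenvector
      ⟨hφE, fun h => hφ0 (congrArg Subtype.val h)⟩
  · obtain ⟨⟨ψ, hψ⟩, hψE, hψ0⟩ := hev.exists_hasEigenvector
    have hψz : F.transfer ψ = z • ψ :=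
      congrArg Subtype.val (Module.End.mem_eigenspace_iff.1 hψE)
    exact (F.eigenfunction_eq_const_mul_norm hstar hψ hz hψz
      fun h => hψ0 (Subtype.ext h)).1
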